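/- Let $\Bbbk$ be an algebraically closed field of characteristic zero, let $\mathcal C$ be a finite tensor category over $\Bbbk$ (a rigid monoidal finite $\Bbbk$-linear abelian category with $\Bbbk$-bilinear tensor product and simple unit $\mathbf 1$), and let $\mathcal M$ be an exact indecomposable finite left $\mathcal C$-module category with action $\triangleright$. The dual category $\mathcal C^*_{\mathcal M}$ has as objects the right exact $\mathcal C$-module endofunctors of $\mathcal M$ and as morphisms the natural module transformations; its tensor product is composition. Let $\mathcal D\subseteq \mathcal C^*_{\mathcal M}$ be a tensor subcategory (a full subcategory containing the unit and closed under finite direct sums, subobjects, quotients, tensor products and left and right duals). For $M,N\in\mathcal M$ the internal Hom $\underline{\mathrm{Hom}}(M,N)\in\mathcal C$ exists. It is given by natural bijections $\psi:\mathrm{Hom}_{\mathcal M}(X\triangleright M,N)\to \mathrm{Hom}_{\mathcal C}(X,\underline{\mathrm{Hom}}(M,N))$. Put $\mathrm{ev}_{M,N}=\psi^{-1}(\mathrm{id}):\underline{\mathrm{Hom}}(M,N)\triangleright M\to N$. Up to the associativity and unit isomorphisms, put $\mathrm{coev}_M=\psi(\mathrm{id}_M):\mathbf 1\to\underline{\mathrm{Hom}}(M,M)$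 and $$\mathrm{comp}_M=\psi\big(\mathrm{ev}_{M,M}(\mathrm{id}\triangleright \mathrm{ev}_{M,M})\big):\underline{\mathrm{Hom}}(M,M)\otimes\underline{\mathrm{Hom}}(M,M)\to\underline{\mathrm{Hom}}(M,M).$$ For $X\in\mathcal C$ let $\mathfrak a_{X,M,N}:\underline{\mathrm{Hom}}(M,X\triangleright N)\to X\otimes\underline{\mathrm{Hom}}(M,N)$ be the $\mathcal C$-module structure of the right adjoint $\underline{\mathrm{Hom}}(M,-)$ of $-\triangleright M$; it is the inverse of $\psi(\mathrm{id}_X\triangleright\mathrm{ev}_{M,N})$. Let $\mathfrak b^1_{X,M,N}:\underline{\mathrm{Hom}}(X\triangleright M,N)\to\underline{\mathrm{Hom}}(M,N)\otimes X^*$ be the map induced by the bijections $\mathrm{Hom}(Z\triangleright(X\triangleright M),N)\simeq\mathrm{Hom}((Z\otimes X)\triangleright M,N)\simeq\mathrm{Hom}(Z\otimes X,\underline{\mathrm{Hom}}(M,N))\simeq\mathrm{Hom}(Z,\underline{\mathrm{Hom}}(M,N)\otimes X^*)$. Put $\mathfrak b_{X,M,N}=(\mathrm{id}\otimes\mathrm{ev}_X)(\mathfrak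 b^1_{X,M,N}\otimes\mathrm{id}_X):\underline{\mathrm{Hom}}(X\triangleright M,N)\otimes X\to\underline{\mathrm{Hom}}(M,N)$. For $D\in\mathcal D$ let $D^{\mathrm{la}}$ be its dual, that is, its left adjoint with the induced module structure $\tilde d_{X,M}:D^{\mathrm{la}}(X\triangleright M)\to X\triangleright D^{\mathrm{la}}(M)$. Let $\mathrm{ev}_D:D^{\mathrm{la}}D\to\mathrm{Id}$ be the counit of the adjunction, let $\alpha:\mathrm{Hom}(D^{\mathrm{la}}(-),-)\to\mathrm{Hom}(-,D(-))$ be its bijections, and let $$\xi^D_{M,N}=\psi\big(\alpha^{-1}(\mathrm{ev}_{M,D(N)})\,\tilde d^{-1}_{\underline{\mathrm{Hom}}(M,D(N)),M}\big):\underline{\mathrm{Hom}}(M,D(N))\to\underline{\mathrm{Hom}}(D^{\mathrm{la}}(M),N).$$ The relative end $\mathcal A=\mathcal A_{\mathcal D,\mathcal M}=\oint_{M\in\mathcal M}\underline{\mathrm{Hom}}(M,M)$ is an object of $\mathcal C$ with a dinatural family $\pi_M:\mathcal A\to\underline{\mathrm{Hom}}(M,M)$ that satisfies $$\underline{\mathrm{Hom}}((\mathrm{ev}_D)_M,\mathrm{id}_M)\,\pi_M=\xi^D_{D(M),M}\,\pi_{D(M)}\qquad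 (D\in\mathcal D,\ M\in\mathcal M)$$ and is universal among the objects with such a family. Then the relative end $\mathcal A$ exists. For every $X\in\mathcal C$ there is a unique morphism $\sigma_X:\mathcal A\otimes X\to X\otimes\mathcal A$ such that $$(\mathrm{id}_X\otimes\pi_M)\,\sigma_X=\mathfrak a_{X,M,M}\,\mathfrak b_{X,M,X\triangleright M}\,(\pi_{X\triangleright M}\otimes\mathrm{id}_X)\quad\text{for all } M\in\mathcal M,$$ and there are unique morphisms $m:\mathcal A\otimes\mathcal A\to\mathcal A$ and $u:\mathbf 1\to\mathcal A$ such that $$\pi_M\, m=\mathrm{comp}_M(\pi_M\otimes\pi_M),\qquad \pi_M\, u=\mathrm{coev}_M\quad\text{for all } M\in\mathcal M.$$ The family $\sigma$ is a half-braiding on $\mathcal A$, and $(\mathcal A,\sigma)$ with multiplication $m$ and unit $u$ is a commutative algebra in the Drinfeld center $Z(\mathcal C)$; in particular $m\,\sigma_{\mathcal A}=m$. -/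

import Mathlib

open CategoryTheory CategoryTheory.Limits MonoidalCategory MonoidalLeftAction Opposite

noncomputable section

namespace RelAdj

universe w v u v' u'

/-! ## Finite tensor categories -/

/-- A finite `k`-linear abelian category: finite-dimensional spaces of morphisms, objects of
finite length, enough projectives, and finitely many isomorphism classes of simple objects. -/
class IsFiniteLinear (k : Type w) [Field k] (A : Type u) [Category.{v} A] [Abelian A]
    [Linear k A] : Prop where
  finite_hom : ∀ X Y : A, Module.Finite k (X ⟶ Y)
  noetherian : ∀ X : A, IsNoetherianObject X
  artinian : ∀ X : A, IsArtinianObject X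
  enoughProjectives : EnoughProjectives A
  finite_simples : ∃ S : Set A, S.Finite ∧ ∀ X : A, Simple X → ∃ Y ∈ S, Nonempty (X ≅ Y)

/-- A finite tensor category over `k`: a finite `k`-linear abelian category with a rigid monoidal
structure (the class `RigidCategory`), `k`-bilinear tensor product (the classes
`MonoidalPreadditive`, `MonoidalLinear`) and simple unit object. -/
class IsFiniteTensorCategory (k : Type w) [Field k] (C : Type u) [Category.{v} C] [Abelian C]
    [Linear k C] [MonoidalCategory C] [MonoidalPreadditive C] [MonoidalLinear k C]
    [RigidCategory C] : Prop where
  finite : IsFiniteLinear k C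
  simple_unit : Simple (𝟙_ C)

/-! ## Module categories -/

/-- A (finite, `k`-linear, left) module category over `C`: the action (the class
`MonoidalLeftAction`) is `k`-bilinear and exact in each variable. -/
class IsModuleCategory (k : Type w) [Field k] (C : Type u) [Category.{v} C] [Abelian C]
    [Linear k C] [MonoidalCategory C]
    (M : Type u') [Category.{v'} M] [Abelian M] [Linear k M] [MonoidalLeftAction C M] :
    Prop where
  finite : IsFiniteLinear k M
  additive_left : ∀ X : C, (actionLeft M X).Additive
  linear_left : ∀ X : C, (actionLeft M X).Linear k
  preservesFiniteLimits_left : ∀ X : C, PreservesFiniteLimits (actionLeft M X)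
  preservesFiniteColimits_left : ∀ X : C, PreservesFiniteColimits (actionLeft M X)
  additive_right : ∀ m : M, (actionRight C m).Additive
  linear_right : ∀ m : M, (actionRight C m).Linear k
  preservesFiniteLimits_right : ∀ m : M, PreservesFiniteLimits (actionRight C m)
  preservesFiniteColimits_right : ∀ m : M, PreservesFiniteColimits (actionRight C m)

section Module

variable (C : Type u) [Category.{v} C] [MonoidalCategory C]
variable (M : Type u') [Category.{v'} M] [Abelian M] [MonoidalLeftAction C M]

/-- A module category is exact if `P ▷ m` is projective for every projective `P` of `C`. -/
def IsExactModule : Prop :=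
  ∀ (P : C) (m : M), Projective P → Projective (P ⊙ₗ m)

/-- A module category is indecomposable if it is not a direct sum of two non-trivial module
categories, that is: if the full subcategories `P` and `Q` are stable under the action, mutually
orthogonal, and every object is a direct sum of one in `P` and one in `Q`, then one of the two
is zero. -/
def IsIndecomposableModule : Prop :=
  ∀ P Q : ObjectProperty M,
    (∀ (X : C) (m : M), P m → P (X ⊙ₗ m)) →
    (∀ (X : C) (m : M), Q m → Q (X ⊙ₗ m)) →
    (∀ (m n : M), P m → Q n → (∀ f : m ⟶ n, f = 0) ∧ (∀ g : n ⟶ m, g = 0)) →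
    (∀ m : M, ∃ p q : M, P p ∧ Q q ∧ Nonempty (m ≅ p ⊞ q)) →
    (∀ m : M, P m → IsZero m) ∨ (∀ m : M, Q m → IsZero m)

end Module

/-! ## The dual category `C^*_M` -/

section Dual

variable (k : Type w) [Field k]
variable (C : Type u) [Category.{v} C] [MonoidalCategory C]
variable (M : Type u') [Category.{v'} M] [Abelian M] [Linear k M] [MonoidalLeftAction C M]

/-- An object `(D, d)` of `C^*_M`: a `k`-linear right exact `C`-module endofunctor of `M`.
The isomorphism `d_{X,m} : D (X ▷ m) ⟶ X ▷ D m` is `δₗ D X m`, with inverse `μₗ D X m`. -/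
structure ModEndo where
  /-- the underlying functor -/
  F : M ⥤ M
  [leftLinear : F.LeftLinear C]
  [additive : F.Additive]
  [linear : F.Linear k]
  [rightExact : PreservesFiniteColimits F]

attribute [instance] ModEndo.leftLinear ModEndo.additive ModEndo.linear ModEndo.rightExact

namespace ModEndo

open Functor.LaxLeftLinear Functor.OplaxLeftLinear

variable {k C M}

/-- A natural module transformation. -/
@[ext]
structure Hom (D E : ModEndo k C M) where
  /-- the underlying natural transformation -/
  θ : D.F ⟶ E.F
  comm : ∀ (X : C) (m : M), θ.app (X ⊙ₗ m) ≫ δₗ E.F X m = δₗ D.F X m ≫ X ⊴ₗ θ.app m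

instance : Category (ModEndo k C M) where
  Hom := Hom
  id D := { θ := 𝟙 _, comm := by simp }
  comp f g :=
    { θ := f.θ ≫ g.θ
      comm := fun X m => by simp [g.comm, reassoc_of% (f.comm X m)] }
  id_comp _ := Hom.ext (Category.id_comp _)
  comp_id _ := Hom.ext (Category.comp_id _)
  assoc _ _ _ := Hom.ext (Category.assoc _ _ _)

variable (k C M) in
/-- The identity module functor, the unit object of `C^*_M`. -/
def unit : ModEndo k C M where
  F := 𝟭 M
  leftLinear :=
    { μₗ := fun _ _ => 𝟙 _
      δₗ := fun _ _ => 𝟙 _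
      μₗ_naturality_left := by simp
      μₗ_naturality_right := by simp
      μₗ_associativity := by simp
      μₗ_unitality := by simp
      δₗ_naturality_left := by simp
      δₗ_naturality_right := by simp
      δₗ_associativity := by simp
      δₗ_unitality_inv := by simp
      μₗ_comp_δₗ := by simp
      δₗ_comp_μₗ := by simp }

/-- The composition `D ∘ E` of module functors, the tensor product of `C^*_M`. -/
def comp (D E : ModEndo k C M) : ModEndo k C M where
  F := E.F ⋙ D.F
  leftLinear :=
    { μₗ := fun X m => μₗ D.F X (E.F.obj m) ≫ D.F.map (μₗ E.F X m)
      δₗ := fun X m => D.F.map (δₗ E.F X m) ≫ δₗ D.F X (E.F.obj m)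
      μₗ_naturality_left := by
        intro X Y f m
        simp [← Functor.map_comp]
      μₗ_naturality_right := by
        intro X m n f
        rw [Functor.comp_map, μₗ_naturality_right_assoc, Category.assoc, ← Functor.map_comp,
          μₗ_naturality_right, Functor.map_comp, Functor.comp_map]
      μₗ_associativity := by
        intro X Y m
        simp only [Functor.comp_obj, Functor.comp_map, Category.assoc, ← Functor.map_comp,
          μₗ_associativity, actionHomRight_comp]
        simp only [Functor.map_comp, μₗ_associativity_assoc, μₗ_naturality_right_assoc]
      μₗ_unitality := by
        intro m
        simp only [Functor.comp_obj, Functor.comp_map, Category.assoc, ← Functor.map_comp,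
          ← μₗ_unitality]
      δₗ_naturality_left := by
        intro X Y f m
        simp [← Functor.map_comp_assoc]
      δₗ_naturality_right := by
        intro X m n f
        rw [Functor.comp_map, ← Functor.map_comp_assoc, δₗ_naturality_right, Functor.map_comp,
          Category.assoc, Category.assoc, δₗ_naturality_right, Functor.comp_map]
      δₗ_associativity := by
        intro X Y m
        simp only [Functor.comp_obj, Functor.comp_map, Category.assoc, actionHomRight_comp,
          δₗ_associativity, ← δₗ_naturality_right_assoc]
        simp only [← Functor.map_comp_assoc, δₗ_associativity]
      δₗ_unitality_inv := by
        intro m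
        simp only [Functor.comp_obj, Functor.comp_map, ← Functor.map_comp_assoc,
          ← δₗ_unitality_inv]
      μₗ_comp_δₗ := by
        intro X m
        simp [← Functor.map_comp_assoc]
      δₗ_comp_μₗ := by
        intro X m
        simp [← Functor.map_comp] }

end ModEndo

variable {k C M}

/-- `E` is a dual `D^*` of `D` in `C^*_M`: an adjunction `E ⊣ D` whose unit
`Id ⟶ D ∘ E` (the coevaluation) and counit `E ∘ D ⟶ Id` (the evaluation) are natural
module transformations. Thus `E` is the left adjoint `D^{la}` with its induced module structure. -/
structure DualData (D E : ModEndo k C M) where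
  /-- the adjunction between the underlying functors -/
  adj : E.F ⊣ D.F
  /-- the coevaluation -/
  coev : ModEndo.unit k C M ⟶ D.comp E
  /-- the evaluation -/
  ev : E.comp D ⟶ ModEndo.unit k C M
  coev_eq : coev.θ = adj.unit
  ev_eq : ev.θ = adj.counit

/-- A tensor subcategory of `C^*_M`: a full subcategory closed under finite direct sums,
subobjects, quotients, tensor products (and containing the unit), and left and right duals. -/
structure IsTensorSubcategory (D : ObjectProperty (ModEndo k C M)) : Prop where
  finiteProducts : D.IsClosedUnderFiniteProducts
  subobjects : D.IsClosedUnderSubobjects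
  quotients : D.IsClosedUnderQuotients
  unit_mem : D (ModEndo.unit k C M)
  comp_mem : ∀ E F : ModEndo k C M, D E → D F → D (E.comp F)
  leftDual : ∀ E : ModEndo k C M, D E → ∃ E' : ModEndo k C M, D E' ∧ Nonempty (DualData E E')
  rightDual : ∀ E : ModEndo k C M, D E → ∃ E' : ModEndo k C M, D E' ∧ Nonempty (DualData E' E)

end Dual

/-! ## The internal Hom -/

section InternalHom

variable {C : Type u} [Category.{v} C] [MonoidalCategory C]
variable {M : Type u'} [Category.{v'} M] [MonoidalLeftAction C M]

variable (C M) in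
/-- An internal Hom of the module category `M`: a functor `hom : Mᵒᵖ ⥤ M ⥤ C` with
bijections `(X ▷ m ⟶ n) ≃ (X ⟶ hom(m, n))` that are natural in all three variables. -/
structure InternalHom where
  /-- the bifunctor -/
  hom : Mᵒᵖ ⥤ M ⥤ C
  /-- the representing bijections -/
  adj₂ : (curriedAction C M).flip ⊣₂ hom

namespace InternalHom

lemma assoc_aux (X Y Z : C) (n : M) :
    (αₗ (X ⊗ Y) Z n).inv ≫ (α_ X Y Z).hom ⊵ₗ n ≫ (αₗ X (Y ⊗ Z) n).hom =
      (αₗ X Y (Z ⊙ₗ n)).hom ≫ X ⊴ₗ (αₗ Y Z n).inv := by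
  rw [Iso.inv_comp_eq, ← associator_actionHom_assoc, ← actionHomRight_comp, Iso.hom_inv_id,
    actionHomRight_id, Category.comp_id]

lemma assoc_aux' (X Y Z : C) (n : M) :
    (αₗ X (Y ⊗ Z) n).inv ≫ (α_ X Y Z).inv ⊵ₗ n ≫ (αₗ (X ⊗ Y) Z n).hom =
      X ⊴ₗ (αₗ Y Z n).hom ≫ (αₗ X Y (Z ⊙ₗ n)).inv := by
  rw [Iso.inv_comp_eq, ← Category.assoc (αₗ _ _ _).hom, Iso.eq_comp_inv, Category.assoc,
    ← associator_actionHom, ← comp_actionHomLeft_assoc, Iso.inv_hom_id, id_actionHomLeft,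
    Category.id_comp]

/-- The first zigzag identity of a dual pair, acting on a module category. -/
lemma zigzag_left (X Y : C) [ExactPairing X Y] (n : M) :
    (λₗ[C] (X ⊙ₗ n)).inv ≫ η_ X Y ⊵ₗ (X ⊙ₗ n) ≫ (αₗ _ _ _).hom ≫
      X ⊴ₗ (αₗ _ _ _).inv ≫ X ⊴ₗ ε_ X Y ⊵ₗ n ≫ X ⊴ₗ (λₗ n).hom = 𝟙 _ := by
  have h := congrArg (fun f => (αₗ _ _ _).inv ≫ f ⊵ₗ n ≫ (ρ_ X).hom ⊵ₗ n)
    (ExactPairing.evaluation_coevaluation X Y)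
  simp only [comp_actionHomLeft, whiskerLeft_actionHomLeft, whiskerRight_actionHomLeft,
    Category.assoc, Iso.inv_hom_id_assoc, leftUnitor_actionHom] at h
  rw [← comp_actionHomLeft (ρ_ X).inv, Iso.inv_hom_id, id_actionHomLeft, Category.comp_id,
    rightUnitor_actionHom, Iso.inv_hom_id_assoc, reassoc_of% assoc_aux] at h
  rw [h, Iso.inv_hom_id]

/-- The second zigzag identity of a dual pair, acting on a module category. -/
lemma zigzag_right (X Y : C) [ExactPairing X Y] (n : M) :
    Y ⊴ₗ (λₗ[C] n).inv ≫ Y ⊴ₗ η_ X Y ⊵ₗ n ≫ Y ⊴ₗ (αₗ _ _ _).hom ≫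
      (αₗ _ _ _).inv ≫ ε_ X Y ⊵ₗ (Y ⊙ₗ n) ≫ (λₗ[C] (Y ⊙ₗ n)).hom = 𝟙 _ := by
  have h := congrArg (fun f => (αₗ _ _ _).inv ≫ f ⊵ₗ n ≫ (λ_ Y).hom ⊵ₗ n)
    (ExactPairing.coevaluation_evaluation X Y)
  simp only [comp_actionHomLeft, whiskerLeft_actionHomLeft, whiskerRight_actionHomLeft,
    Category.assoc, Iso.inv_hom_id_assoc, rightUnitor_actionHom] at h
  rw [← comp_actionHomLeft (λ_ Y).inv, Iso.inv_hom_id, id_actionHomLeft, Category.comp_id,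
    leftUnitor_actionHom, Iso.inv_hom_id_assoc, reassoc_of% assoc_aux'] at h
  rw [h, ← actionHomRight_comp, Iso.inv_hom_id, actionHomRight_id]

lemma unit_aux (X : C) (n : M) :
    (λ_ X).inv ⊵ₗ n ≫ (αₗ (𝟙_ C) X n).hom = (λₗ (X ⊙ₗ n)).inv := by
  rw [← Iso.eq_comp_inv, ← cancel_mono ((λ_ X).hom ⊵ₗ n), ← comp_actionHomLeft,
    Iso.inv_hom_id, id_actionHomLeft, leftUnitor_actionHom, Category.assoc,
    Iso.inv_hom_id_assoc, Iso.inv_hom_id]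

variable (H : InternalHom C M)

/-- The object `hom(m, n)`. -/
abbrev obj (m n : M) : C := (H.hom.obj (op m)).obj n

/-- `hom(m, f)`. -/
abbrev mapRight (m : M) {n n' : M} (f : n ⟶ n') : H.obj m n ⟶ H.obj m n' :=
  (H.hom.obj (op m)).map f

/-- `hom(g, n)`. -/
abbrev mapLeft {m m' : M} (g : m ⟶ m') (n : M) : H.obj m' n ⟶ H.obj m n :=
  (H.hom.map g.op).app n

/-- The bijection `ψ^X_{m,n}`, with inverse `φ^X_{m,n}`. -/
def ψ {X : C} {m n : M} : (X ⊙ₗ m ⟶ n) ≃ (X ⟶ H.obj m n) :=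
  H.adj₂.homEquiv (X₁ := m) (X₂ := X) (X₃ := n)

lemma ψ_comp {X Y : C} {m n : M} (f : X ⟶ Y) (g : Y ⊙ₗ m ⟶ n) :
    f ≫ H.ψ g = H.ψ (f ⊵ₗ m ≫ g) :=
  (H.adj₂.homEquiv_naturality_two f g).symm

/-- `coev_m : 1 ⟶ hom(m, m)`. -/
def coev (m : M) : 𝟙_ C ⟶ H.obj m m := H.ψ (λₗ m).hom

/-- `ev_{m,n} : hom(m, n) ▷ m ⟶ n`. -/
def ev (m n : M) : H.obj m n ⊙ₗ m ⟶ n := H.ψ.symm (𝟙 _)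

lemma ψ_ev {X : C} {m n : M} (g : X ⊙ₗ m ⟶ n) : H.ψ g ⊵ₗ m ≫ H.ev m n = g := by
  apply H.ψ.injective
  rw [← ψ_comp, ev, Equiv.apply_symm_apply, Category.comp_id]

/-- `comp_m : hom(m, m) ⊗ hom(m, m) ⟶ hom(m, m)`. -/
def comp (m : M) : H.obj m m ⊗ H.obj m m ⟶ H.obj m m :=
  H.ψ ((αₗ _ _ _).hom ≫ H.obj m m ⊴ₗ H.ev m m ≫ H.ev m m)

/-- The canonical comparison `X ⊗ hom(m, n) ⟶ hom(m, X ▷ n)`; it is the mate of the module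
structure of `X ↦ X ▷ m`. -/
def aInv (X : C) (m n : M) : X ⊗ H.obj m n ⟶ H.obj m (X ⊙ₗ n) :=
  H.ψ ((αₗ _ _ _).hom ≫ X ⊴ₗ H.ev m n)

/-- The map `hom(m, X ▷ n) ⟶ X ⊗ hom(m, n)` obtained, for a dual `Y = X^*` of `X`, from
`hom(m, X ▷ n) ▷ m ⟶ X ▷ n` by means of `Y ▷ X ▷ n ⟶ n`. -/
def aHom (X Y : C) [ExactPairing X Y] (m n : M) : H.obj m (X ⊙ₗ n) ⟶ X ⊗ H.obj m n :=
  tensorLeftHomEquiv _ X Y _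
    (H.ψ ((αₗ _ _ _).hom ≫ Y ⊴ₗ H.ev m (X ⊙ₗ n) ≫ (αₗ _ _ _).inv ≫
      ε_ X Y ⊵ₗ n ≫ (λₗ n).hom))

lemma aHom_aInv (X Y : C) [ExactPairing X Y] (m n : M) :
    H.aHom X Y m n ≫ H.aInv X m n = 𝟙 _ := by
  unfold aHom
  rw [aInv, ψ_comp, ← H.ψ.eq_symm_apply]
  change _ = H.ev m (X ⊙ₗ n)
  have e1 : ∀ {Z Z' : M} (f : Z ⟶ Z'),
      (αₗ X Y Z).hom ≫ X ⊴ₗ Y ⊴ₗ f = (X ⊗ Y) ⊴ₗ f ≫ (αₗ X Y Z').hom := by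
    intro Z Z' f; simp
  have e2 : ∀ {Z Z' : M} (f : Z ⟶ Z'),
      η_ X Y ⊵ₗ Z ≫ (X ⊗ Y) ⊴ₗ f = 𝟙_ C ⊴ₗ f ≫ η_ X Y ⊵ₗ Z' := by
    intro Z Z' f; rw [action_exchange]
  have e3 : ∀ {Z Z' : M} (f : Z ⟶ Z'),
      (λₗ[C] Z).inv ≫ 𝟙_ C ⊴ₗ f = f ≫ (λₗ[C] Z').inv := by
    intro Z Z' f; simp
  simp only [tensorLeftHomEquiv, Equiv.coe_fn_mk, comp_actionHomLeft, Category.assoc,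
    whiskerLeft_actionHomLeft, whiskerRight_actionHomLeft, Iso.inv_hom_id_assoc,
    ← actionHomRight_comp, ψ_ev]
  simp only [actionHomRight_comp]
  rw [reassoc_of% assoc_aux, reassoc_of% unit_aux, ← actionHomRight_comp_assoc X (αₗ _ _ _).inv,
    Iso.inv_hom_id, actionHomRight_id, Category.id_comp, reassoc_of% e1, reassoc_of% e2,
    reassoc_of% e3, zigzag_left, Category.comp_id]

lemma aInv_aHom (X Y : C) [ExactPairing X Y] (m n : M) :
    H.aInv X m n ≫ H.aHom X Y m n = 𝟙 _ := by
  unfold aHom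
  apply (tensorLeftHomEquiv _ X Y _).symm.injective
  rw [tensorLeftHomEquiv_symm_naturality, Equiv.symm_apply_apply, ψ_comp, ← H.ψ.eq_symm_apply]
  apply H.ψ.injective
  rw [Equiv.apply_symm_apply]
  have e1 : ∀ {Z Z' : M} (f : Z ⟶ Z'),
      Y ⊴ₗ X ⊴ₗ f ≫ (αₗ Y X Z').inv = (αₗ Y X Z).inv ≫ (Y ⊗ X) ⊴ₗ f := by
    intro Z Z' f; simp
  have e2 : ∀ {Z Z' : M} (f : Z ⟶ Z'),
      (Y ⊗ X) ⊴ₗ f ≫ ε_ X Y ⊵ₗ Z' = ε_ X Y ⊵ₗ Z ≫ 𝟙_ C ⊴ₗ f := by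
    intro Z Z' f; rw [action_exchange]
  have e3 : ∀ {Z Z' : M} (f : Z ⟶ Z'),
      𝟙_ C ⊴ₗ f ≫ (λₗ[C] Z').hom = (λₗ[C] Z).hom ≫ f := by
    intro Z Z' f; simp
  simp only [tensorLeftHomEquiv, Equiv.coe_fn_symm_mk, Category.assoc,
    whiskerLeft_actionHomLeft, Iso.inv_hom_id_assoc,
    ← actionHomRight_comp_assoc, ψ_ev, aInv]
  simp only [actionHomRight_comp, Category.assoc]
  rw [reassoc_of% e1, reassoc_of% e2, e3]
  have e4 : ∀ f : Y ⊗ X ⊗ H.obj m n ⟶ H.obj m n, f = H.ψ (f ⊵ₗ m ≫ H.ev m n) := by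
    intro f
    rw [← ψ_comp, ev, Equiv.apply_symm_apply, Category.comp_id]
  rw [MonoidalCategory.whiskerLeft_id, Category.id_comp, e4 ((α_ _ _ _).inv ≫ _)]
  congr 1
  simp only [comp_actionHomLeft, whiskerRight_actionHomLeft, leftUnitor_actionHom,
    Category.assoc, Iso.inv_hom_id_assoc]
  rw [← cancel_epi (αₗ Y (X ⊗ H.obj m n) m).inv, reassoc_of% assoc_aux',
    Iso.inv_hom_id_assoc]

section Rigid

variable [RigidCategory C]

/-- The module structure `𝔞_{X,m,n} : hom(m, X ▷ n) ≅ X ⊗ hom(m, n)` of the right adjoint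
`hom(m, -)` of the module functor `X ↦ X ▷ m`. -/
def a (X : C) (m n : M) : H.obj m (X ⊙ₗ n) ≅ X ⊗ H.obj m n where
  hom := H.aHom X (Xᘁ) m n
  inv := H.aInv X m n
  hom_inv_id := H.aHom_aInv X (Xᘁ) m n
  inv_hom_id := H.aInv_aHom X (Xᘁ) m n

/-- `𝔟¹_{X,m,n} : hom(X ▷ m, n) ⟶ hom(m, n) ⊗ X^*`, obtained from
`Hom(Z ▷ (X ▷ m), n) ≃ Hom((Z ⊗ X) ▷ m, n) ≃ Hom(Z ⊗ X, hom(m, n)) ≃ Hom(Z, hom(m, n) ⊗ X^*)`. -/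
def b₁ (X : C) (m n : M) : H.obj (X ⊙ₗ m) n ⟶ H.obj m n ⊗ Xᘁ :=
  tensorRightHomEquiv _ X Xᘁ _ (H.ψ ((αₗ _ _ _).hom ≫ H.ev (X ⊙ₗ m) n))

/-- `𝔟_{X,m,n} : hom(X ▷ m, n) ⊗ X ⟶ hom(m, n)`. -/
def b (X : C) (m n : M) : H.obj (X ⊙ₗ m) n ⊗ X ⟶ H.obj m n :=
  H.b₁ X m n ▷ X ≫ (α_ _ _ _).hom ≫ H.obj m n ◁ ε_ X Xᘁ ≫ (ρ_ _).hom

end Rigid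

end InternalHom

end InternalHom

/-! ## The relative end -/

section RelativeEnd

variable {k : Type w} [Field k]
variable {C : Type u} [Category.{v} C] [MonoidalCategory C]
variable {M : Type u'} [Category.{v'} M] [Abelian M] [Linear k M] [MonoidalLeftAction C M]

open Functor.LaxLeftLinear

/-- The isomorphism `ξ^D_{m,n} : hom(m, D n) ⟶ hom(D^{la} m, n)`, which is
`ψ (α⁻¹ (ev_{m, D n}) ∘ d̃⁻¹)`, where `α` is the bijection of the adjunction `D^{la} ⊣ D` and
`d̃` is the module structure of `D^{la}`. These maps are the prebalancing of the internal Hom. -/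
def ξ (H : InternalHom C M) {D E : ModEndo k C M} (d : DualData D E) (m n : M) :
    H.obj m (D.F.obj n) ⟶ H.obj (E.F.obj m) n :=
  H.ψ (μₗ E.F (H.obj m (D.F.obj n)) m ≫ (d.adj.homEquiv _ _).symm (H.ev m (D.F.obj n)))

/-- An object with a dinatural transformation to `hom(m, m)` that is compatible with the
prebalancing `ξ` with respect to the full subcategory `D` of `C^*_M`. -/
structure RelativeWedge (D : ObjectProperty (ModEndo k C M)) (H : InternalHom C M) where
  /-- the vertex -/
  pt : C
  /-- the dinatural transformation -/
  π : ∀ m : M, pt ⟶ H.obj m m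
  dinatural : ∀ {m n : M} (f : m ⟶ n), π m ≫ H.mapRight m f = π n ≫ H.mapLeft f n
  balanced : ∀ {E E' : ModEndo k C M} (_ : D E) (d : DualData E E') (m : M),
    π m ≫ H.mapLeft (d.adj.counit.app m) m = π (E.F.obj m) ≫ ξ H d (E.F.obj m) m

/-- The universal property of the relative end `∮_{m ∈ M} (hom(m, m), ξ)`. -/
def RelativeWedge.IsRelativeEnd {D : ObjectProperty (ModEndo k C M)} {H : InternalHom C M}
    (A : RelativeWedge D H) : Prop :=
  ∀ W : RelativeWedge D H, ∃! h : W.pt ⟶ A.pt, ∀ m : M, h ≫ A.π m = W.π m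

variable {D : ObjectProperty (ModEndo k C M)} {H : InternalHom C M}

/-- The diagram relating a morphism `s : A ⊗ X ⟶ X ⊗ A` and `π`:
`(id_X ⊗ π_m) s = 𝔞_{X,m,m} 𝔟_{X,m,X ▷ m} (π_{X ▷ m} ⊗ id_X)` for all `m`. -/
def RelativeWedge.BraidingDiagram [RigidCategory C] (A : RelativeWedge D H) (X : C)
    (s : A.pt ⊗ X ⟶ X ⊗ A.pt) : Prop :=
  ∀ m : M, s ≫ X ◁ A.π m = A.π (X ⊙ₗ m) ▷ X ≫ H.b X m (X ⊙ₗ m) ≫ (H.a X m m).hom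

/-- `π_m ∘ μ = comp_m ∘ (π_m ⊗ π_m)` for all `m`. -/
def RelativeWedge.MulEquation (A : RelativeWedge D H) (μ : A.pt ⊗ A.pt ⟶ A.pt) : Prop :=
  ∀ m : M, μ ≫ A.π m = (A.π m ⊗ₘ A.π m) ≫ H.comp m

/-- `π_m ∘ η = coev_m` for all `m`. -/
def RelativeWedge.UnitEquation (A : RelativeWedge D H) (η : 𝟙_ C ⟶ A.pt) : Prop :=
  ∀ m : M, η ≫ A.π m = H.coev m

/-- The object `(A, σ)` of the Drinfeld center `Z(C)`. -/
def centerObj (A : C) (σ : HalfBraiding A) : Center C := Sigma.mk A σ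

end RelativeEnd

end RelAdj

end

/-!
Every wedge `π_m : Z ⟶ hom(m, m)` transposes to a family of maps `φ_m : Z ▷ m ⟶ m`. Dinaturality
says that `φ` is natural in `m`, and, because the counit of `E' ⊣ E` is a module transformation, the
balancing condition says that `φ` is compatible with each module functor `E` in `D`
(`RelAdj.balanced_iff`). Hence a relative end `A` is a universal object that acts on all objects
of `M` by maps `act_m : A ▷ m ⟶ m` commuting with the morphisms of `M` and with the functors in `D`.

By rigidity the universal property extends to families `Z ▷ m ⟶ X ▷ m`: they correspond to
morphisms `Z ⟶ X ⊗ A`, by composition with the action of `A` on `m`, and also to morphisms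
`Z ⟶ A ⊗ X`, by composition with the action of `A` on `X ▷ m` (`hom_ext_left`, `exists_left`,
`hom_ext_right`, `exists_right`). The diagram for `σ_X` says that `σ_X` intertwines the families
`A ▷ X ▷ m ⟶ X ▷ m` and `X ▷ A ▷ m ⟶ X ▷ m` given by the actions on `X ▷ m` and on `m`. So `σ_X`
exists, is unique, and is invertible, its inverse being given by the second correspondence. The
multiplication and the unit are induced by the iterated action `A ▷ A ▷ m ⟶ m` and by `1 ▷ m ≅ m`,
and all axioms are checked after acting on an arbitrary `m`. Commutativity `m σ_A = m` is the
naturality of `act` with respect to the morphism `act_m : A ▷ m ⟶ m` (`braid_mul`).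

Two existence statements precede this. The internal Hom exists because a right exact linear functor
`F` between finite linear categories has a right adjoint. Let `P` be a projective object that maps
nontrivially to every nonzero object. If `x : F X ⟶ n` does not factor through a proper quotient of
`X`, then `f ↦ x ∘ F f` embeds `Hom (P, X)` into `Hom (F P, n)`, and such a pair `(X, x)` with
`dim Hom (P, X)` maximal represents `X ↦ Hom (F X, n)` (`RelAdj.exists_terminal_pair`). The relative
end exists because a wedge is determined by its component at a projective object `P` of `M` of the
same kind, so that the largest subobject of `hom(P, P)` whose inclusion extends to a wedge is
universal (`RelAdj.RelativeWedge.exists_isRelativeEnd`).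
-/

namespace RelAdj

universe w v u v' u'

/-! ### Finite linear categories and right adjoints -/

section FiniteLinear

attribute [local instance] Abelian.hasFiniteBiproducts

variable (k : Type w) [Field k]
variable (A : Type u) [Category.{v} A] [Abelian A] [Linear k A]

/-- The sum of projective objects that map onto the simple objects detects zero objects. -/
lemma exists_projective_detecting (h : IsFiniteLinear k A) :
    ∃ P : A, Projective P ∧ ∀ Q : A, (∀ f : P ⟶ Q, f = 0) → IsZero Q := by
  have := h.enoughProjectives
  obtain ⟨S, hS, hsimple⟩ := h.finite_simples
  have := hS.fintype
  refine ⟨⨁ fun s : S => Projective.over s.1, ⟨fun f e _ => ⟨biproduct.desc fun s =>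
    Projective.factorThru (biproduct.ι (fun s : S => Projective.over s.1) s ≫ f) e, by
      ext s; simp⟩⟩, fun Q hQ => ?_⟩
  by_contra hne
  have := h.artinian Q
  obtain ⟨T, hT⟩ := exists_simple_subobject hne
  obtain ⟨Y, hY, ⟨e⟩⟩ := hsimple _ hT
  have h0 := hQ (biproduct.π (fun s : S => Projective.over s.1) ⟨Y, hY⟩ ≫
    Projective.π Y ≫ e.inv ≫ T.arrow)
  have h1 : T.arrow = 0 := by
    simpa [← cancel_epi e.inv, ← cancel_epi (Projective.π Y),
      ← cancel_epi (biproduct.π (fun s : S => Projective.over s.1) ⟨Y, hY⟩)] using h0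
  exact Simple.not_isZero (T : A) (IsZero.of_mono_eq_zero _ h1)

variable {A}

/-- If a projective object `P` detects zero objects, then every object is a quotient of a power
of `P`. -/
lemma exists_epi_desc (h : IsFiniteLinear k A) {P : A} (hP : Projective P)
    (hdet : ∀ Q : A, (∀ f : P ⟶ Q, f = 0) → IsZero Q) (m : A) :
    ∃ (n : ℕ) (f : Fin n → (P ⟶ m)), Epi (biproduct.desc f) := by
  have := h.finite_hom P m
  obtain ⟨n, f, hf⟩ := Module.Finite.exists_fin (R := k) (M := P ⟶ m)
  refine ⟨n, f, ?_⟩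
  apply Abelian.epi_of_cokernel_π_eq_zero
  refine (hdet _ fun g => ?_).eq_zero_of_tgt _
  obtain ⟨g, rfl⟩ : ∃ g', g' ≫ cokernel.π (biproduct.desc f) = g :=
    ⟨_, Projective.factorThru_comp g _⟩
  have hg : g ∈ Submodule.span k (Set.range f) := hf ▸ Submodule.mem_top
  induction hg using Submodule.span_induction with
  | mem x hx =>
    obtain ⟨i, rfl⟩ := hx
    rw [← biproduct.ι_desc f i, Category.assoc, cokernel.condition, comp_zero]
  | zero => rw [zero_comp]
  | add x y _ _ hx hy => rw [Preadditive.add_comp, hx, hy, add_zero]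
  | smul c x _ hx => rw [Linear.smul_comp, hx, smul_zero]

end FiniteLinear

section Adjoint

variable {A : Type u} [Category.{v} A] [Abelian A]
variable {B : Type u'} [Category.{v'} B] [Abelian B]

/-- A pair of an object `X` and a morphism `x : F X ⟶ n` is minimal if `x` does not factor through
a proper quotient of `X`. -/
def IsMinimalPair (F : A ⥤ B) {n : B} (X : A) (x : F.obj X ⟶ n) : Prop :=
  ∀ ⦃T : A⦄ (f : T ⟶ X), F.map f ≫ x = 0 → f = 0

lemma exists_cokernel_desc (F : A ⥤ B) [F.Additive] [PreservesFiniteColimits F] {n : B}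
    {T X : A} (f : T ⟶ X) (x : F.obj X ⟶ n) (h : F.map f ≫ x = 0) :
    ∃ y : F.obj (cokernel f) ⟶ n, F.map (cokernel.π f) ≫ y = x :=
  ⟨(isColimitOfHasCokernelOfPreservesColimit F f).desc (CokernelCofork.ofπ x h),
    (isColimitOfHasCokernelOfPreservesColimit F f).fac (CokernelCofork.ofπ x h)
      WalkingParallelPair.one⟩

variable {k : Type w} [Field k] [Linear k A]

lemma exists_minimal_quotient (F : A ⥤ B) [F.Additive] [PreservesFiniteColimits F]
    (hA : IsFiniteLinear k A) {P : A} (hP : Projective P)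
    (hdet : ∀ Q : A, (∀ f : P ⟶ Q, f = 0) → IsZero Q) {n : B} (X : A) (x : F.obj X ⟶ n) :
    ∃ (Z : A) (q : X ⟶ Z) (z : F.obj Z ⟶ n), F.map q ≫ z = x ∧ IsMinimalPair F Z z := by
  have := hA.finite_hom
  induction hd : Module.finrank k (P ⟶ X) using Nat.strong_induction_on generalizing X with
  | _ d ih =>
    subst hd
    by_cases hmin : IsMinimalPair F X x
    · exact ⟨X, 𝟙 X, x, by simp, hmin⟩
    · simp only [IsMinimalPair, not_forall] at hmin
      obtain ⟨T, f, hf, hf0⟩ := hmin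
      obtain ⟨y, rfl⟩ := exists_cokernel_desc F f x hf
      have hsurj : Function.Surjective (Linear.rightComp k P (cokernel.π f)) := fun g =>
        ⟨Projective.factorThru g (cokernel.π f), Projective.factorThru_comp _ _⟩
      -- the projective `P` maps nontrivially to the image of `f`, which the cokernel kills
      have hlt : Module.finrank k (P ⟶ cokernel f) < Module.finrank k (P ⟶ X) := by
        refine lt_of_le_of_ne (LinearMap.finrank_le_finrank_of_surjective hsurj) fun heq => hf0 ?_
        have hinj := (LinearMap.injective_iff_surjective_of_finrank_eq_finrank heq.symm).2 hsurj
        have hz : IsZero (Limits.image f) := hdet _ fun g => by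
          have : g ≫ image.ι f = 0 := hinj (by
            have h0 : image.ι f ≫ cokernel.π f = 0 := by
              rw [← cancel_epi (factorThruImage f), image.fac_assoc, cokernel.condition, comp_zero]
            simp [h0])
          exact zero_of_comp_mono _ this
        rw [← image.fac f, hz.eq_zero_of_tgt (factorThruImage f), zero_comp]
      obtain ⟨Z, q, z, hz, hmin⟩ := ih _ hlt _ y rfl
      exact ⟨Z, cokernel.π f ≫ q, z, by rw [F.map_comp, Category.assoc, hz], hmin⟩

variable [Linear k B] (F : A ⥤ B) [F.Additive] [F.Linear k]

/-- The multiplicities of the simple objects in the members of minimal pairs are bounded. -/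
lemma IsMinimalPair.finrank_le (hB : IsFiniteLinear k B) (P : A) {n : B} {X : A}
    {x : F.obj X ⟶ n} (h : IsMinimalPair F X x) :
    Module.finrank k (P ⟶ X) ≤ Module.finrank k (F.obj P ⟶ n) := by
  have := hB.finite_hom
  refine LinearMap.finrank_le_finrank_of_injective
    (f := (Linear.rightComp k (F.obj P) x).comp (F.mapLinearMap k)) ?_
  rw [← LinearMap.ker_eq_bot, LinearMap.ker_eq_bot']
  intro f hf
  exact h f hf

variable [PreservesFiniteColimits F]

/-- The functor `X ↦ Hom (F X, n)` is representable: among the minimal pairs, one of largest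
multiplicity is terminal in the category of elements. -/
lemma exists_terminal_pair (hA : IsFiniteLinear k A) (hB : IsFiniteLinear k B)
    (n : B) : ∃ (Y : A) (e : F.obj Y ⟶ n), ∀ (X : A) (x : F.obj X ⟶ n),
      ∃! g : X ⟶ Y, F.map g ≫ e = x := by
  have := hA.finite_hom
  obtain ⟨P, hP, hdet⟩ := exists_projective_detecting k A hA
  obtain ⟨Y, e, hmin, hmax⟩ : ∃ (Y : A) (e : F.obj Y ⟶ n), IsMinimalPair F Y e ∧
      ∀ (Z : A) (z : F.obj Z ⟶ n), IsMinimalPair F Z z →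
        Module.finrank k (P ⟶ Z) ≤ Module.finrank k (P ⟶ Y) := by
    let s : Set ℕ := {d | ∃ (Y : A) (e : F.obj Y ⟶ n), IsMinimalPair F Y e ∧
      Module.finrank k (P ⟶ Y) = d}
    have hne : s.Nonempty := by
      obtain ⟨Z, _, z, _, hz⟩ := exists_minimal_quotient (k := k) F hA hP hdet P (0 : F.obj P ⟶ n)
      exact ⟨_, Z, z, hz, rfl⟩
    have hbdd : BddAbove s := ⟨Module.finrank k (F.obj P ⟶ n), by
      rintro _ ⟨Y, e, h, rfl⟩
      exact h.finrank_le F hB P⟩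
    obtain ⟨Y, e, h, hd⟩ := Nat.sSup_mem hne hbdd
    exact ⟨Y, e, h, fun Z z hz => hd ▸ le_csSup hbdd ⟨Z, z, hz, rfl⟩⟩
  refine ⟨Y, e, fun X x => ?_⟩
  -- a minimal quotient of the sum of the two pairs is isomorphic to `Y` via the first inclusion
  obtain ⟨Z, q, z, hq, hz⟩ := exists_minimal_quotient (k := k) F hA hP hdet (Y ⊞ X)
    (F.map biprod.fst ≫ e + F.map biprod.snd ≫ x)
  have hl : F.map (biprod.inl ≫ q) ≫ z = e := by
    rw [F.map_comp, Category.assoc, hq, Preadditive.comp_add, ← F.map_comp_assoc,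
      ← F.map_comp_assoc]
    simp
  have hr : F.map (biprod.inr ≫ q) ≫ z = x := by
    rw [F.map_comp, Category.assoc, hq, Preadditive.comp_add, ← F.map_comp_assoc,
      ← F.map_comp_assoc]
    simp
  have hmono : Mono (biprod.inl ≫ q) := Preadditive.mono_of_cancel_zero _ fun g hg =>
    hmin g (by rw [← hl, ← F.map_comp_assoc, hg, F.map_zero, zero_comp])
  have hepi : Epi (biprod.inl ≫ q) := by
    apply Abelian.epi_of_cokernel_π_eq_zero
    refine (hdet _ fun g => ?_).eq_zero_of_tgt _
    have hinj : Function.Injective (Linear.rightComp k P (biprod.inl ≫ q)) := fun a b hab =>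
      (cancel_mono (biprod.inl ≫ q)).1 hab
    have hsurj := (LinearMap.injective_iff_surjective_of_finrank_eq_finrank
      (le_antisymm (LinearMap.finrank_le_finrank_of_injective hinj) (hmax Z z hz))).1 hinj
    obtain ⟨a, ha⟩ := hsurj (Projective.factorThru g (cokernel.π (biprod.inl ≫ q)))
    rw [← Projective.factorThru_comp g (cokernel.π (biprod.inl ≫ q)), ← ha]
    change (a ≫ _) ≫ _ = 0
    rw [Category.assoc, cokernel.condition, comp_zero]
  have hiso : IsIso (biprod.inl ≫ q) := isIso_of_mono_of_epi _
  refine ⟨(biprod.inr ≫ q) ≫ inv (biprod.inl ≫ q), ?_, fun g hg => ?_⟩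
  · dsimp only
    rw [← hl, ← F.map_comp_assoc, Category.assoc, IsIso.inv_hom_id, Category.comp_id, hr]
  · rw [← sub_eq_zero]
    apply hmin
    rw [F.map_sub, Preadditive.sub_comp, hg, sub_eq_zero]
    conv_rhs => rw [← hl, ← F.map_comp_assoc, Category.assoc, IsIso.inv_hom_id, Category.comp_id,
      hr]

lemma isLeftAdjoint_of_finite (hA : IsFiniteLinear k A) (hB : IsFiniteLinear k B) :
    F.IsLeftAdjoint := by
  choose Y e h using exists_terminal_pair (k := k) F hA hB
  refine ⟨_, ⟨Adjunction.adjunctionOfEquivRight (F := F) (G_obj := Y)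
    (fun X n => (Equiv.ofBijective (fun g : X ⟶ Y n => F.map g ≫ e n) ⟨fun a b hab =>
      (h n X (F.map b ≫ e n)).unique hab rfl, fun x => (h n X x).exists⟩).symm) ?_⟩⟩
  intro X' X n f g
  rw [Equiv.symm_apply_eq]
  change F.map f ≫ g = F.map (f ≫ _) ≫ e n
  rw [F.map_comp, Category.assoc]
  congr 1
  exact ((Equiv.ofBijective (fun g : X ⟶ Y n => F.map g ≫ e n) _).apply_symm_apply g).symm

end Adjoint

/-- Right adjoints of all functors `X ↦ X ▷ m` assemble to an internal Hom. -/
lemma nonempty_internalHom {k : Type w} [Field k]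
    {C : Type u} [Category.{v} C] [Abelian C] [Linear k C] [MonoidalCategory C]
    {M : Type u'} [Category.{v'} M] [Abelian M] [Linear k M] [MonoidalLeftAction C M]
    (hC : IsFiniteLinear k C) [hM : IsModuleCategory k C M] : Nonempty (InternalHom C M) := by
  have hadj : ∀ m : M, ((curriedAction C M).flip.obj m).IsLeftAdjoint := fun m => by
    have := hM.additive_right m
    have := hM.linear_right m
    have := hM.preservesFiniteColimits_right m
    exact isLeftAdjoint_of_finite (k := k) (actionRight C m) hC hM.finite
  exact ⟨{
    hom :=
      { obj := fun m => ((curriedAction C M).flip.obj m.unop).rightAdjoint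
        map := fun {m m'} f => conjugateEquiv (Adjunction.ofIsLeftAdjoint _)
          (Adjunction.ofIsLeftAdjoint _) ((curriedAction C M).flip.map f.unop)
        map_id := fun m => by
          rw [unop_id, CategoryTheory.Functor.map_id, conjugateEquiv_id]
        map_comp := fun f g => by
          rw [unop_comp, Functor.map_comp, conjugateEquiv_comp] }
    adj₂ :=
      { adj := fun m => Adjunction.ofIsLeftAdjoint _
        unit_whiskerRight_map := fun {m m'} f => by
          ext X
          exact (unit_conjugateEquiv _ _ _ X).symm } }⟩

/-! ### Wedges as central actions -/

section Translation

variable {C : Type u} [Category.{v} C] [MonoidalCategory C]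
variable {M : Type u'} [Category.{v'} M] [MonoidalLeftAction C M]

namespace InternalHom

variable (H : InternalHom C M)

lemma comp_ψ_symm {X Y : C} {m n : M} (f : X ⟶ Y) (p : Y ⟶ H.obj m n) :
    H.ψ.symm (f ≫ p) = f ⊵ₗ m ≫ H.ψ.symm p := by
  rw [Equiv.symm_apply_eq, ← ψ_comp, Equiv.apply_symm_apply]

lemma ψ_symm_eq {X : C} {m n : M} (p : X ⟶ H.obj m n) :
    H.ψ.symm p = p ⊵ₗ m ≫ H.ev m n := by
  rw [ev, ← comp_ψ_symm, Category.comp_id]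

lemma ψ_mapRight {X : C} {m n n' : M} (p : X ⊙ₗ m ⟶ n) (f : n ⟶ n') :
    H.ψ p ≫ H.mapRight m f = H.ψ (p ≫ f) :=
  (H.adj₂.homEquiv_naturality_three f p).symm

lemma ψ_mapLeft {X : C} {m m' n : M} (p : X ⊙ₗ m' ⟶ n) (f : m ⟶ m') :
    H.ψ p ≫ H.mapLeft f n = H.ψ (X ⊴ₗ f ≫ p) :=
  (H.adj₂.homEquiv_naturality_one f p).symm

end InternalHom

end Translation

section Central

open Functor.LaxLeftLinear Functor.OplaxLeftLinear Functor.LeftLinear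

variable {k : Type w} [Field k]
variable {C : Type u} [Category.{v} C] [MonoidalCategory C]
variable {M : Type u'} [Category.{v'} M] [Abelian M] [Linear k M] [MonoidalLeftAction C M]

/-- The counit `E' E ⟶ Id` of a dual pair is a natural module transformation. -/
lemma DualData.counit_module {E E' : ModEndo k C M} (d : DualData E E') (X : C) (m : M) :
    d.adj.counit.app (X ⊙ₗ m) =
      E'.F.map (δₗ E.F X m) ≫ δₗ E'.F X (E.F.obj m) ≫ X ⊴ₗ d.adj.counit.app m := by
  have h := d.ev.comm X m
  rw [d.ev_eq] at h
  refine Eq.trans ?_ (h.trans (Category.assoc _ _ _))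
  exact (Category.comp_id _).symm

/-- The counit of a dual pair, precomposed with the module structures. -/
lemma DualData.μ_counit {E E' : ModEndo k C M} (d : DualData E E') (X : C) (m : M) :
    E'.F.map (μₗ E.F X m) ≫ d.adj.counit.app (X ⊙ₗ m) =
      δₗ E'.F X (E.F.obj m) ≫ X ⊴ₗ d.adj.counit.app m := by
  rw [d.counit_module, ← Functor.map_comp_assoc, μₗ_comp_δₗ, CategoryTheory.Functor.map_id,
    Category.id_comp]

/-- A family `τ_m : Z ▷ m ⟶ X ▷ m` that is natural in `m` and compatible with the module functors
in `D` that have a dual. For `X = 1` this amounts to the notion `IsCentralAction`. -/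
structure IsCentral (D : ObjectProperty (ModEndo k C M)) {Z X : C}
    (τ : ∀ m : M, Z ⊙ₗ m ⟶ X ⊙ₗ m) : Prop where
  natural : ∀ {m n : M} (f : m ⟶ n), Z ⊴ₗ f ≫ τ n = τ m ≫ X ⊴ₗ f
  equivariant : ∀ {E E' : ModEndo k C M}, D E → DualData E E' → ∀ m : M,
    τ (E.F.obj m) ≫ μₗ E.F X m = μₗ E.F Z m ≫ E.F.map (τ m)

/-- A family `φ_m : Z ▷ m ⟶ m` that is natural in `m` and compatible with the module functors
in `D` that have a dual. -/
structure IsCentralAction (D : ObjectProperty (ModEndo k C M)) {Z : C}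
    (φ : ∀ m : M, Z ⊙ₗ m ⟶ m) : Prop where
  natural : ∀ {m n : M} (f : m ⟶ n), Z ⊴ₗ f ≫ φ n = φ m ≫ f
  equivariant : ∀ {E E' : ModEndo k C M}, D E → DualData E E' → ∀ m : M,
    φ (E.F.obj m) = μₗ E.F Z m ≫ E.F.map (φ m)

variable {D : ObjectProperty (ModEndo k C M)} {H : InternalHom C M}

lemma IsCentralAction.precomp {Z Z' : C} {φ : ∀ m : M, Z ⊙ₗ m ⟶ m}
    (h : IsCentralAction D φ) (l : Z' ⟶ Z) : IsCentralAction D fun m => l ⊵ₗ m ≫ φ m where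
  natural f := by rw [action_exchange_assoc, h.natural, Category.assoc]
  equivariant hE d m := by
    rw [Functor.map_comp, ← μₗ_naturality_left_assoc, h.equivariant hE d]

/-- The balancing condition of a wedge, expressed by the transposed family. Both conditions are
equalities between maps that correspond to each other under the adjunction `E' ⊣ E`. -/
lemma balanced_iff (H : InternalHom C M) {E E' : ModEndo k C M} (d : DualData E E') {Z : C} {m : M}
    (φ : ∀ m : M, Z ⊙ₗ m ⟶ m) :
    H.ψ (φ m) ≫ H.mapLeft (d.adj.counit.app m) m =
        H.ψ (φ (E.F.obj m)) ≫ ξ H d (E.F.obj m) m ↔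
      φ (E.F.obj m) = μₗ E.F Z m ≫ E.F.map (φ m) := by
  have hξ : H.ψ (φ (E.F.obj m)) ≫ ξ H d (E.F.obj m) m =
      H.ψ (μₗ E'.F Z (E.F.obj m) ≫ (d.adj.homEquiv _ _).symm (φ (E.F.obj m))) := by
    rw [ξ, InternalHom.ψ_comp, μₗ_naturality_left_assoc, ← Adjunction.homEquiv_naturality_left_symm,
      InternalHom.ψ_ev]
  rw [hξ, InternalHom.ψ_mapLeft, H.ψ.apply_eq_iff_eq, ← (d.adj.homEquiv _ _).symm.apply_eq_iff_eq,
    ← cancel_epi (μₗ E'.F Z (E.F.obj m)), eq_comm]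
  refine Eq.congr_right ?_
  -- the transpose of `E (φ m) ∘ μ` is computed by the module property of the counit
  rw [Adjunction.homEquiv_counit, Functor.map_comp, Category.assoc]
  erw [Adjunction.counit_naturality]
  rw [reassoc_of% d.μ_counit, μₗ_comp_δₗ_assoc]

namespace RelativeWedge

variable (A : RelativeWedge D H)

/-- The action `A ▷ m ⟶ m` that corresponds to `π_m : A ⟶ hom(m, m)`. -/
def act (m : M) : A.pt ⊙ₗ m ⟶ m := H.ψ.symm (A.π m)

lemma ψ_act (m : M) : H.ψ (A.act m) = A.π m := Equiv.apply_symm_apply _ _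

lemma act_eq (m : M) : A.π m ⊵ₗ m ≫ H.ev m m = A.act m := (H.ψ_symm_eq _).symm

lemma isCentralAction_act : IsCentralAction D A.act where
  natural {m n} f := by
    apply H.ψ.injective
    rw [← H.ψ_mapLeft, ← H.ψ_mapRight, ψ_act, ψ_act, A.dinatural]
  equivariant hE d m := by
    rw [← balanced_iff H d, ψ_act, ψ_act]
    exact A.balanced hE d m

lemma act_natural {m n : M} (f : m ⟶ n) : A.pt ⊴ₗ f ≫ A.act n = A.act m ≫ f :=
  A.isCentralAction_act.natural f

/-- The wedge that corresponds to a central action. -/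
def ofCentralAction (H : InternalHom C M) {Z : C} {φ : ∀ m : M, Z ⊙ₗ m ⟶ m}
    (h : IsCentralAction D φ) : RelativeWedge D H where
  pt := Z
  π m := H.ψ (φ m)
  dinatural {m n} f := by rw [H.ψ_mapLeft, H.ψ_mapRight, h.natural]
  balanced hE d m := (balanced_iff H d φ).2 (h.equivariant hE d m)

/-- The universal property of a relative end in terms of central actions. -/
lemma IsRelativeEnd.existsUnique {A : RelativeWedge D H} (hA : A.IsRelativeEnd) {Z : C}
    {φ : ∀ m : M, Z ⊙ₗ m ⟶ m} (h : IsCentralAction D φ) :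
    ∃! l : Z ⟶ A.pt, ∀ m, l ⊵ₗ m ≫ A.act m = φ m := by
  have key : ∀ l : Z ⟶ A.pt, (∀ m, l ⊵ₗ m ≫ A.act m = φ m) ↔
      ∀ m, l ≫ A.π m = H.ψ (φ m) := fun l => forall_congr' fun m => by
    rw [act, ← H.comp_ψ_symm, Equiv.symm_apply_eq]
  simp only [key]
  exact hA (ofCentralAction H h)

/-- Morphisms to a relative end are determined by the induced actions. -/
lemma IsRelativeEnd.hom_ext {A : RelativeWedge D H} (hA : A.IsRelativeEnd) {Z : C}
    {f g : Z ⟶ A.pt} (h : ∀ m, f ⊵ₗ m ≫ A.act m = g ⊵ₗ m ≫ A.act m) : f = g :=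
  (hA.existsUnique (A.isCentralAction_act.precomp g)).unique h fun _ => rfl

end RelativeWedge

end Central

/-! ### Existence of the relative end -/

section Existence

open Functor.LaxLeftLinear Functor.OplaxLeftLinear Functor.LeftLinear

attribute [local instance] Abelian.hasFiniteBiproducts

variable {k : Type w} [Field k]
variable {C : Type u} [Category.{v} C] [MonoidalCategory C]
variable {M : Type u'} [Category.{v'} M] [Abelian M] [Linear k M] [MonoidalLeftAction C M]
variable {D : ObjectProperty (ModEndo k C M)} {H : InternalHom C M}

namespace RelativeWedge

/-- A wedge is determined by its component at an object whose powers have all objects as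
quotients. -/
lemma π_eq_of_generator [Abelian C] [Linear k C] [hM : IsModuleCategory k C M] {P : M}
    (hP : ∀ m : M, ∃ (n : ℕ) (f : Fin n → (P ⟶ m)), Epi (biproduct.desc f))
    {V W : RelativeWedge D H} (l : V.pt ⟶ W.pt) (h : l ≫ W.π P = V.π P) (m : M) :
    l ≫ W.π m = V.π m := by
  have := hM.additive_left V.pt
  have := hM.preservesFiniteColimits_left V.pt
  have hact : ∀ m, l ≫ W.π m = V.π m ↔ l ⊵ₗ m ≫ W.act m = V.act m := fun m => by
    rw [act, ← H.comp_ψ_symm, act, Equiv.apply_eq_iff_eq]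
  rw [hact] at h ⊢
  obtain ⟨n, f, hf⟩ := hP m
  have hepi : Epi (V.pt ⊴ₗ biproduct.desc f) :=
    inferInstanceAs (Epi ((actionLeft M V.pt).map (biproduct.desc f)))
  have hpow : l ⊵ₗ (⨁ fun _ : Fin n => P) ≫ W.act _ = V.act _ := by
    have htotal : ∑ i : Fin n, V.pt ⊴ₗ (biproduct.π (fun _ : Fin n => P) i ≫
        biproduct.ι (fun _ : Fin n => P) i) = 𝟙 _ := by
      have := congrArg (actionLeft M V.pt).map (biproduct.total (f := fun _ : Fin n => P))
      rw [Functor.map_sum, CategoryTheory.Functor.map_id] at this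
      exact this
    rw [← Category.id_comp (l ⊵ₗ _ ≫ _), ← Category.id_comp (V.act _), ← htotal,
      Preadditive.sum_comp, Preadditive.sum_comp]
    refine Finset.sum_congr rfl fun i _ => ?_
    rw [actionHomRight_comp, Category.assoc, Category.assoc, action_exchange_assoc, act_natural,
      reassoc_of% h, act_natural]
  rw [← cancel_epi (V.pt ⊴ₗ biproduct.desc f), action_exchange_assoc, act_natural,
    reassoc_of% hpow, act_natural]

/-- Restriction of a wedge along a morphism. -/
@[simps]
def precomp (W : RelativeWedge D H) {Z : C} (f : Z ⟶ W.pt) : RelativeWedge D H where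
  pt := Z
  π m := f ≫ W.π m
  dinatural g := by simp only [Category.assoc, W.dinatural]
  balanced hE d m := by simp only [Category.assoc, W.balanced hE d]

variable [Abelian C]

/-- The zero wedge. -/
@[simps]
def zero (D : ObjectProperty (ModEndo k C M)) (H : InternalHom C M) (Z : C) :
    RelativeWedge D H where
  pt := Z
  π _ := 0
  dinatural g := by simp only [zero_comp]
  balanced hE d m := by simp only [zero_comp]

/-- The sum of two wedges. -/
@[simps]
noncomputable def sum (V W : RelativeWedge D H) : RelativeWedge D H where
  pt := V.pt ⊞ W.pt
  π m := biprod.desc (V.π m) (W.π m)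
  dinatural g := by
    ext
    · simp only [biprod.inl_desc_assoc, V.dinatural]
    · simp only [biprod.inr_desc_assoc, W.dinatural]
  balanced hE d m := by
    ext
    · simp only [biprod.inl_desc_assoc, V.balanced hE d]
    · simp only [biprod.inr_desc_assoc, W.balanced hE d]

/-- A wedge descends to the image of its component at a generator. -/
lemma exists_descend [Linear k C] [hM : IsModuleCategory k C M] {P : M}
    (hP : ∀ m : M, ∃ (n : ℕ) (f : Fin n → (P ⟶ m)), Epi (biproduct.desc f))
    (W : RelativeWedge D H) {I : C} (e : W.pt ⟶ I) [Epi e] (i : I ⟶ H.obj P P)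
    (hi : e ≫ i = W.π P) : ∃ (V : RelativeWedge D H) (φ : V.pt ≅ I), V.π P = φ.hom ≫ i := by
  have hker : ∀ m, kernel.ι e ≫ W.π m = 0 := fun m =>
    π_eq_of_generator (k := k) hP (V := zero D H (kernel e)) (kernel.ι e)
      (show kernel.ι e ≫ W.π P = 0 by rw [← hi, kernel.condition_assoc, zero_comp]) m
  have hfac : ∀ m, e ≫ Abelian.epiDesc e (W.π m) (hker m) = W.π m := fun m =>
    Abelian.comp_epiDesc _ _ _
  refine ⟨⟨I, fun m => Abelian.epiDesc e (W.π m) (hker m), fun g => ?_, fun hE d m => ?_⟩,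
    Iso.refl _, ?_⟩
  · rw [← cancel_epi e, reassoc_of% hfac, reassoc_of% hfac, W.dinatural]
  · rw [← cancel_epi e, reassoc_of% hfac, reassoc_of% hfac, W.balanced hE d]
  · rw [Iso.refl_hom, Category.id_comp, ← cancel_epi e, hfac, hi]

/-- The relative end is the largest subobject of `hom(P, P)`, for a generator `P`, whose inclusion
extends to a wedge. -/
lemma exists_isRelativeEnd [Linear k C] [hM : IsModuleCategory k C M] (hC : IsFiniteLinear k C)
    (D : ObjectProperty (ModEndo k C M)) (H : InternalHom C M) :
    ∃ A : RelativeWedge D H, A.IsRelativeEnd := by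
  obtain ⟨P, hproj, hdet⟩ := exists_projective_detecting k M hM.finite
  have hP := exists_epi_desc k hM.finite hproj hdet
  have := hC.noetherian (H.obj P P)
  let s : Set (Subobject (H.obj P P)) :=
    {S | ∃ (W : RelativeWedge D H) (φ : W.pt ≅ (S : C)), W.π P = φ.hom ≫ S.arrow}
  -- the image of `W.π P` is a member of `s`, for each wedge `W`
  have himage : ∀ W : RelativeWedge D H, imageSubobject (W.π P) ∈ s := fun W =>
    exists_descend (k := k) hP W (factorThruImageSubobject (W.π P)) _ (imageSubobject_arrow_comp _)
  obtain ⟨S, hS, hmax⟩ := WellFounded.has_min (wellFounded_gt (α := Subobject (H.obj P P))) s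
    ⟨_, himage (zero D H (𝟙_ C))⟩
  obtain ⟨A, φ, hφ⟩ := hS
  have hmono : Mono (A.π P) := by rw [hφ]; infer_instance
  refine ⟨A, fun W => ?_⟩
  -- by maximality, `S` is also the image of the component at `P` of the sum of `A` and `W`
  let p : A.pt ⊞ W.pt ⟶ H.obj P P := biprod.desc (A.π P) (W.π P)
  have hle : S ≤ imageSubobject p :=
    Subobject.le_of_comm (φ.inv ≫ biprod.inl ≫ factorThruImageSubobject p) (by
      rw [Category.assoc, Category.assoc, imageSubobject_arrow_comp, biprod.inl_desc, hφ,
        Iso.inv_hom_id_assoc])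
  have heq : S = imageSubobject p := hle.eq_of_not_lt (hmax _ (himage (A.sum W)))
  have hfac : S.Factors (W.π P) := by
    rw [heq, ← biprod.inr_desc (A.π P) (W.π P)]
    exact imageSubobject_factors_comp_self _ _
  refine ⟨S.factorThru _ hfac ≫ φ.inv, π_eq_of_generator (k := k) hP _ ?_, fun g hg => ?_⟩
  · rw [hφ, Category.assoc, Iso.inv_hom_id_assoc, Subobject.factorThru_arrow]
  · rw [← cancel_mono (A.π P), hg, hφ, Category.assoc, Iso.inv_hom_id_assoc,
      Subobject.factorThru_arrow]

end RelativeWedge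

end Existence

/-! ### Central families and dual objects -/

section Cap

variable {C : Type u} [Category.{v} C] [MonoidalCategory C]
variable {M : Type u'} [Category.{v'} M] [MonoidalLeftAction C M]

/-- The map `Y ▷ X ▷ m ⟶ m` induced by the evaluation of a dual pair. -/
def cap (X Y : C) [ExactPairing X Y] (m : M) : Y ⊙ₗ X ⊙ₗ m ⟶ m :=
  (αₗ Y X m).inv ≫ ε_ X Y ⊵ₗ m ≫ (λₗ m).hom

/-- The map `m ⟶ X ▷ Y ▷ m` induced by the coevaluation of a dual pair. -/
def cup (X Y : C) [ExactPairing X Y] (m : M) : m ⟶ X ⊙ₗ Y ⊙ₗ m :=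
  (λₗ m).inv ≫ η_ X Y ⊵ₗ m ≫ (αₗ X Y m).hom

variable (X Y : C) [ExactPairing X Y]

lemma tensor_act (X Y : C) {m n : M} (f : m ⟶ n) :
    (X ⊗ Y) ⊴ₗ f ≫ (αₗ X Y n).hom = (αₗ X Y m).hom ≫ X ⊴ₗ Y ⊴ₗ f := by
  simp

lemma whiskerRight_act {X X' : C} (f : X ⟶ X') (Y : C) (m : M) :
    (f ▷ Y) ⊵ₗ m ≫ (αₗ X' Y m).hom = (αₗ X Y m).hom ≫ f ⊵ₗ (Y ⊙ₗ m) := by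
  rw [whiskerRight_actionHomLeft, Category.assoc, Category.assoc, Iso.inv_hom_id, Category.comp_id]

lemma whiskerLeft_act (X : C) {Y Y' : C} (f : Y ⟶ Y') (m : M) :
    (X ◁ f) ⊵ₗ m ≫ (αₗ X Y' m).hom = (αₗ X Y m).hom ≫ X ⊴ₗ f ⊵ₗ m := by
  rw [whiskerLeft_actionHomLeft, Category.assoc, Category.assoc, Iso.inv_hom_id, Category.comp_id]

lemma cap_natural {m n : M} (f : m ⟶ n) :
    Y ⊴ₗ X ⊴ₗ f ≫ cap X Y n = cap X Y m ≫ f := by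
  have h : Y ⊴ₗ X ⊴ₗ f ≫ (αₗ Y X n).inv = (αₗ Y X m).inv ≫ (Y ⊗ X) ⊴ₗ f := by simp
  simp only [cap, reassoc_of% h, action_exchange_assoc, Category.assoc,
    actionUnitIso_hom_naturality]

lemma cup_cap (m : M) : cup X Y (X ⊙ₗ m) ≫ X ⊴ₗ cap X Y m = 𝟙 _ := by
  simp only [cup, cap, actionHomRight_comp, Category.assoc]
  exact InternalHom.zigzag_left X Y m

lemma cup_cap' (m : M) : Y ⊴ₗ cup X Y m ≫ cap X Y (Y ⊙ₗ m) = 𝟙 _ := by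
  simp only [cup, cap, actionHomRight_comp, Category.assoc]
  exact InternalHom.zigzag_right X Y m

lemma cup_natural {m n : M} (f : m ⟶ n) :
    f ≫ cup X Y n = cup X Y m ≫ X ⊴ₗ Y ⊴ₗ f := by
  simp only [cup, Category.assoc, ← tensor_act, ← action_exchange_assoc,
    actionUnitIso_inv_naturality_assoc]

lemma cap_tensor (Z : C) (m : M) :
    ((α_ Y X Z).inv ≫ ε_ X Y ▷ Z ≫ (λ_ Z).hom) ⊵ₗ m =
      (αₗ Y (X ⊗ Z) m).hom ≫ Y ⊴ₗ (αₗ X Z m).hom ≫ cap X Y (Z ⊙ₗ m) := by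
  simp only [cap, comp_actionHomLeft, whiskerRight_actionHomLeft, leftUnitor_actionHom,
    Category.assoc, Iso.inv_hom_id_assoc]
  rw [← cancel_epi (αₗ Y (X ⊗ Z) m).inv, reassoc_of% InternalHom.assoc_aux' Y X Z m,
    Iso.inv_hom_id_assoc]

lemma cup_tensor (Z : C) (m : M) :
    ((λ_ Z).inv ≫ η_ X Y ▷ Z ≫ (α_ X Y Z).hom) ⊵ₗ m ≫ (αₗ X (Y ⊗ Z) m).hom ≫
      X ⊴ₗ (αₗ Y Z m).hom = cup X Y (Z ⊙ₗ m) := by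
  simp only [cup, comp_actionHomLeft, Category.assoc, associator_actionHom]
  rw [reassoc_of% whiskerRight_act, ← InternalHom.unit_aux, Category.assoc]

lemma cap_tensor_right (Z : C) (m : M) :
    ((α_ Z Y X).hom ≫ Z ◁ ε_ X Y ≫ (ρ_ Z).hom) ⊵ₗ m =
      (αₗ (Z ⊗ Y) X m).hom ≫ (αₗ Z Y (X ⊙ₗ m)).hom ≫ Z ⊴ₗ cap X Y m := by
  simp only [cap, comp_actionHomLeft, actionHomRight_comp, whiskerLeft_actionHomLeft,
    rightUnitor_actionHom, Category.assoc, Iso.inv_hom_id_assoc]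
  rw [← associator_actionHom_assoc, ← actionHomRight_comp_assoc Z (αₗ Y X m).hom, Iso.hom_inv_id,
    actionHomRight_id, Category.id_comp]

lemma cup_tensor_right (Z : C) (m : M) :
    ((ρ_ Z).inv ≫ Z ◁ η_ X Y ≫ (α_ Z X Y).inv) ⊵ₗ m ≫ (αₗ (Z ⊗ X) Y m).hom ≫
      (αₗ Z X (Y ⊙ₗ m)).hom = Z ⊴ₗ cup X Y m := by
  have h : (ρ_ Z).inv ⊵ₗ m ≫ (αₗ Z (𝟙_ C) m).hom = Z ⊴ₗ (λₗ m).inv := by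
    rw [← cancel_epi ((ρ_ Z).hom ⊵ₗ m), hom_inv_actionHomLeft_assoc, rightUnitor_actionHom,
      Category.assoc, ← actionHomRight_comp, Iso.hom_inv_id, actionHomRight_id, Category.comp_id]
  simp only [cup, comp_actionHomLeft, actionHomRight_comp, Category.assoc]
  rw [← h, Category.assoc, ← reassoc_of% whiskerLeft_act, ← associator_actionHom,
    inv_hom_actionHomLeft_assoc]

/-- The map `𝔟` is the transpose of an evaluation: passing to `X^*` and back has no effect. -/
lemma InternalHom.b_eq [RigidCategory C] (H : InternalHom C M) (X : C) (m n : M) :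
    H.b X m n = H.ψ ((αₗ (H.obj (X ⊙ₗ m) n) X m).hom ≫ H.ev (X ⊙ₗ m) n) :=
  (tensorRightHomEquiv _ X Xᘁ _).symm_apply_apply _

end Cap

section Central

open Functor.LaxLeftLinear Functor.OplaxLeftLinear Functor.LeftLinear

variable {k : Type w} [Field k]
variable {C : Type u} [Category.{v} C] [MonoidalCategory C]
variable {M : Type u'} [Category.{v'} M] [Abelian M] [Linear k M] [MonoidalLeftAction C M]
variable {D : ObjectProperty (ModEndo k C M)} {H : InternalHom C M}

/-- A module functor is compatible with evaluations. -/
lemma map_cap {M : Type u'} [Category.{v'} M] [MonoidalLeftAction C M] (F : M ⥤ M)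
    [F.LeftLinear C] (X Y : C) [ExactPairing X Y] (m : M) :
    Y ⊴ₗ μₗ F X m ≫ μₗ F Y (X ⊙ₗ m) ≫ F.map (cap X Y m) = cap X Y (F.obj m) := by
  simp only [cap, Functor.map_comp, μₗ_associativity_inv_assoc, ← μₗ_naturality_left_assoc,
    μₗ_unitality]

/-- A central family `Z ▷ m ⟶ X ▷ m` yields a central action of `Y ⊗ Z`, for a dual `Y` of `X`. -/
lemma IsCentral.transposeLeft {Z X : C} {τ : ∀ m : M, Z ⊙ₗ m ⟶ X ⊙ₗ m} (h : IsCentral D τ) (Y : C)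
    [ExactPairing X Y] :
    IsCentralAction D fun m => (αₗ Y Z m).hom ≫ Y ⊴ₗ τ m ≫ cap X Y m where
  natural f := by
    rw [reassoc_of% tensor_act, ← actionHomRight_comp_assoc, h.natural, actionHomRight_comp_assoc,
      cap_natural, Category.assoc, Category.assoc]
  equivariant {E E'} hE d m := by
    simp only [Functor.map_comp, μₗ_associativity_assoc, ← μₗ_naturality_right_assoc]
    rw [← actionHomRight_comp_assoc, ← h.equivariant hE d, actionHomRight_comp_assoc, map_cap]

/-- A central family `Z ▷ m ⟶ X ▷ m` yields a central action of `Z ⊗ Y`, for a dual `Y` of `X`. -/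
lemma IsCentral.transposeRight {Z X : C} {τ : ∀ m : M, Z ⊙ₗ m ⟶ X ⊙ₗ m} (h : IsCentral D τ)
    (Y : C) [ExactPairing Y X] :
    IsCentralAction D fun m => (αₗ Z Y m).hom ≫ τ (Y ⊙ₗ m) ≫ cap Y X m where
  natural f := by
    rw [reassoc_of% tensor_act, reassoc_of% h.natural, cap_natural, Category.assoc, Category.assoc]
  equivariant {E E'} hE d m := by
    simp only [Functor.map_comp, μₗ_associativity_assoc]
    rw [reassoc_of% (h.equivariant hE d (Y ⊙ₗ m)).symm, reassoc_of% h.natural, map_cap]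

namespace RelativeWedge

variable (A : RelativeWedge D H)

/-- The action of `A` on `X ▷ m`, as a central family. -/
lemma isCentral_actRight (X : C) :
    IsCentral D fun m => (αₗ A.pt X m).hom ≫ A.act (X ⊙ₗ m) where
  natural f := by rw [reassoc_of% tensor_act, act_natural, Category.assoc]
  equivariant {E E'} hE d m := by
    rw [Functor.map_comp, μₗ_associativity_assoc, ← A.isCentralAction_act.equivariant hE d,
      act_natural, Category.assoc]

/-- The action of `A` on `m`, acted upon by `X`, as a central family. -/
lemma isCentral_actLeft (X : C) :
    IsCentral D fun m => (αₗ X A.pt m).hom ≫ X ⊴ₗ A.act m where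
  natural f := by
    rw [reassoc_of% tensor_act, ← actionHomRight_comp, act_natural, actionHomRight_comp,
      Category.assoc]
  equivariant {E E'} hE d m := by
    rw [Functor.map_comp, μₗ_associativity_assoc, ← μₗ_naturality_right,
      A.isCentralAction_act.equivariant hE d, actionHomRight_comp, Category.assoc, Category.assoc]

lemma isCentralAction_act_act :
    IsCentralAction D fun m => (αₗ A.pt A.pt m).hom ≫ A.pt ⊴ₗ A.act m ≫ A.act m where
  natural f := by
    rw [reassoc_of% tensor_act, ← actionHomRight_comp_assoc, A.act_natural f,
      actionHomRight_comp_assoc, A.act_natural f, Category.assoc, Category.assoc]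
  equivariant {E E'} hE d m := by
    simp only [Functor.map_comp, μₗ_associativity_assoc, ← μₗ_naturality_right_assoc]
    rw [A.isCentralAction_act.equivariant hE d, actionHomRight_comp, Category.assoc]

lemma isCentralAction_unit (D : ObjectProperty (ModEndo k C M)) :
    IsCentralAction D fun m : M => (λₗ[C] m).hom where
  natural f := (actionUnitIso_hom_naturality f).symm
  equivariant _ _ _ := μₗ_unitality _ _

lemma transposeLeft_act {Z X : C} (Y : C) [ExactPairing X Y] (h : Z ⟶ X ⊗ A.pt) (m : M) :
    ((tensorLeftHomEquiv Z X Y A.pt).symm h) ⊵ₗ m ≫ A.act m =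
      (αₗ Y Z m).hom ≫ Y ⊴ₗ (h ⊵ₗ m ≫ (αₗ X A.pt m).hom ≫ X ⊴ₗ A.act m) ≫ cap X Y m := by
  simp only [tensorLeftHomEquiv, Equiv.coe_fn_symm_mk]
  rw [comp_actionHomLeft (Y ◁ h), cap_tensor]
  simp only [Category.assoc, reassoc_of% whiskerLeft_act, actionHomRight_comp, cap_natural]

lemma transposeRight_act {Z X : C} (Y : C) [ExactPairing Y X] (h : Z ⟶ A.pt ⊗ X) (m : M) :
    ((tensorRightHomEquiv Z Y X A.pt).symm h) ⊵ₗ m ≫ A.act m =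
      (αₗ Z Y m).hom ≫ (h ⊵ₗ (Y ⊙ₗ m) ≫ (αₗ A.pt X (Y ⊙ₗ m)).hom ≫ A.act (X ⊙ₗ Y ⊙ₗ m)) ≫
        cap Y X m := by
  simp only [tensorRightHomEquiv, Equiv.coe_fn_symm_mk]
  rw [comp_actionHomLeft (h ▷ Y), cap_tensor_right]
  simp only [Category.assoc, reassoc_of% whiskerRight_act, act_natural]

namespace IsRelativeEnd

variable {A}

section Rigid

variable [RigidCategory C]

/-- Morphisms to `X ⊗ A` are determined by the induced maps `Z ▷ m ⟶ X ▷ m`. -/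
lemma hom_ext_left (hA : A.IsRelativeEnd) {Z X : C} {f g : Z ⟶ X ⊗ A.pt}
    (h : ∀ m, f ⊵ₗ m ≫ (αₗ X A.pt m).hom ≫ X ⊴ₗ A.act m =
      g ⊵ₗ m ≫ (αₗ X A.pt m).hom ≫ X ⊴ₗ A.act m) : f = g := by
  apply (tensorLeftHomEquiv Z X Xᘁ A.pt).symm.injective
  refine hA.hom_ext fun m => ?_
  rw [transposeLeft_act, transposeLeft_act, h]

/-- Morphisms to `A ⊗ X` are determined by the induced maps `Z ▷ m ⟶ X ▷ m`. -/
lemma hom_ext_right (hA : A.IsRelativeEnd) {Z X : C} {f g : Z ⟶ A.pt ⊗ X}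
    (h : ∀ m, f ⊵ₗ m ≫ (αₗ A.pt X m).hom ≫ A.act (X ⊙ₗ m) =
      g ⊵ₗ m ≫ (αₗ A.pt X m).hom ≫ A.act (X ⊙ₗ m)) : f = g := by
  apply (tensorRightHomEquiv Z (ᘁX) X A.pt).symm.injective
  refine hA.hom_ext fun m => ?_
  rw [transposeRight_act, transposeRight_act, h]

/-- Central families `Z ▷ m ⟶ X ▷ m` are induced by morphisms to `X ⊗ A`. -/
lemma exists_left (hA : A.IsRelativeEnd) {Z X : C} {τ : ∀ m : M, Z ⊙ₗ m ⟶ X ⊙ₗ m}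
    (h : IsCentral D τ) :
    ∃ f : Z ⟶ X ⊗ A.pt, ∀ m, f ⊵ₗ m ≫ (αₗ X A.pt m).hom ≫ X ⊴ₗ A.act m = τ m := by
  obtain ⟨l, hl, -⟩ := hA.existsUnique (h.transposeLeft Xᘁ)
  refine ⟨tensorLeftHomEquiv Z X Xᘁ A.pt l, fun m => ?_⟩
  have e : tensorLeftHomEquiv Z X Xᘁ A.pt l =
      ((λ_ Z).inv ≫ η_ X Xᘁ ▷ Z ≫ (α_ X Xᘁ Z).hom) ≫ X ◁ l := by
    simp [tensorLeftHomEquiv]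
  have hl' : l ⊵ₗ m ≫ A.act m = (αₗ Xᘁ Z m).hom ≫ Xᘁ ⊴ₗ τ m ≫ cap X Xᘁ m := hl m
  rw [e, comp_actionHomLeft, Category.assoc, reassoc_of% whiskerLeft_act, ← actionHomRight_comp,
    hl', actionHomRight_comp, reassoc_of% cup_tensor X Xᘁ Z m, actionHomRight_comp,
    ← reassoc_of% cup_natural, cup_cap, Category.comp_id]

/-- Central families `Z ▷ m ⟶ X ▷ m` are induced by morphisms to `A ⊗ X`. -/
lemma exists_right (hA : A.IsRelativeEnd) {Z X : C} {τ : ∀ m : M, Z ⊙ₗ m ⟶ X ⊙ₗ m}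
    (h : IsCentral D τ) :
    ∃ f : Z ⟶ A.pt ⊗ X, ∀ m, f ⊵ₗ m ≫ (αₗ A.pt X m).hom ≫ A.act (X ⊙ₗ m) = τ m := by
  obtain ⟨l, hl, -⟩ := hA.existsUnique (h.transposeRight ᘁX)
  refine ⟨tensorRightHomEquiv Z (ᘁX) X A.pt l, fun m => ?_⟩
  have e : tensorRightHomEquiv Z (ᘁX) X A.pt l =
      ((ρ_ Z).inv ≫ Z ◁ η_ (ᘁX) X ≫ (α_ Z (ᘁX) X).inv) ≫ l ▷ X := by
    simp [tensorRightHomEquiv]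
  have hl' : l ⊵ₗ (X ⊙ₗ m) ≫ A.act (X ⊙ₗ m) =
      (αₗ Z (ᘁX : C) (X ⊙ₗ m)).hom ≫ τ ((ᘁX : C) ⊙ₗ X ⊙ₗ m) ≫ cap (ᘁX) X (X ⊙ₗ m) := hl (X ⊙ₗ m)
  rw [e, comp_actionHomLeft, Category.assoc, reassoc_of% whiskerRight_act, hl',
    reassoc_of% cup_tensor_right (ᘁX : C) X Z m, reassoc_of% h.natural, cup_cap',
    Category.comp_id]

end Rigid

end IsRelativeEnd

/-! ### The structure morphisms in terms of actions -/

variable {A}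

/-- The diagram defining the half-braiding: it exchanges the action of `A` on `m` and on `X ▷ m`. -/
lemma braidingDiagram_iff [RigidCategory C] {X : C} {s : A.pt ⊗ X ⟶ X ⊗ A.pt} :
    A.BraidingDiagram X s ↔ ∀ m : M, s ⊵ₗ m ≫ (αₗ X A.pt m).hom ≫ X ⊴ₗ A.act m =
      (αₗ A.pt X m).hom ≫ A.act (X ⊙ₗ m) := by
  refine forall_congr' fun m => ?_
  have h : (H.a X m m).inv = H.ψ ((αₗ X (H.obj m m) m).hom ≫ X ⊴ₗ H.ev m m) := rfl
  rw [← cancel_mono (H.a X m m).inv]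
  simp only [Category.assoc, Iso.hom_inv_id, Category.comp_id]
  rw [H.b_eq, h, H.ψ_comp, H.ψ_comp, H.ψ_comp, H.ψ.apply_eq_iff_eq, reassoc_of% whiskerLeft_act,
    reassoc_of% whiskerRight_act, ← actionHomRight_comp, act_eq, act_eq]

lemma mulEquation_iff {μ : A.pt ⊗ A.pt ⟶ A.pt} :
    A.MulEquation μ ↔ ∀ m : M, μ ⊵ₗ m ≫ A.act m =
      (αₗ A.pt A.pt m).hom ≫ A.pt ⊴ₗ A.act m ≫ A.act m := by
  refine forall_congr' fun m => ?_
  rw [← H.ψ.symm.apply_eq_iff_eq, H.comp_ψ_symm, InternalHom.comp, H.ψ_comp,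
    Equiv.symm_apply_apply, MonoidalCategory.tensorHom_def, comp_actionHomLeft, Category.assoc,
    reassoc_of% whiskerLeft_act, reassoc_of% whiskerRight_act, ← actionHomRight_comp_assoc,
    act_eq, ← action_exchange_assoc, act_eq]
  rfl

lemma unitEquation_iff {η : 𝟙_ C ⟶ A.pt} :
    A.UnitEquation η ↔ ∀ m : M, η ⊵ₗ m ≫ A.act m = (λₗ m).hom := by
  refine forall_congr' fun m => ?_
  rw [← H.ψ.symm.apply_eq_iff_eq, H.comp_ψ_symm, InternalHom.coev, Equiv.symm_apply_apply]
  rfl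

end RelativeWedge

end Central

/-! ### The commutative algebra in the Drinfeld center -/

section Center

variable {C : Type u} [Category.{v} C] [MonoidalCategory C]

lemma associator_inv_act {M : Type u'} [Category.{v'} M] [MonoidalLeftAction C M] (U V W : C)
    (m : M) : (α_ U V W).inv ⊵ₗ m ≫ (αₗ (U ⊗ V) W m).hom ≫ (αₗ U V (W ⊙ₗ m)).hom =
      (αₗ U (V ⊗ W) m).hom ≫ U ⊴ₗ (αₗ V W m).hom := by
  rw [← associator_actionHom, inv_hom_actionHomLeft_assoc]

variable {k : Type w} [Field k]
variable {M : Type u'} [Category.{v'} M] [Abelian M] [Linear k M] [MonoidalLeftAction C M]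
variable {D : ObjectProperty (ModEndo k C M)} {H : InternalHom C M}

namespace RelativeWedge.IsRelativeEnd

variable {A : RelativeWedge D H}

section HalfBraiding

variable [RigidCategory C]

lemma existsUnique_braiding (hA : A.IsRelativeEnd) (X : C) :
    ∃! s : A.pt ⊗ X ⟶ X ⊗ A.pt, A.BraidingDiagram X s := by
  obtain ⟨s, hs⟩ := hA.exists_left (A.isCentral_actRight X)
  refine ⟨s, braidingDiagram_iff.2 hs, fun t ht => hA.hom_ext_left fun m => ?_⟩
  rw [braidingDiagram_iff.1 ht, hs]

/-- The morphism `σ_X : A ⊗ X ⟶ X ⊗ A`. -/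
noncomputable def braid (hA : A.IsRelativeEnd) (X : C) : A.pt ⊗ X ⟶ X ⊗ A.pt :=
  (hA.existsUnique_braiding X).choose

lemma braidingDiagram_braid (hA : A.IsRelativeEnd) (X : C) : A.BraidingDiagram X (hA.braid X) :=
  (hA.existsUnique_braiding X).choose_spec.1

lemma braid_act (hA : A.IsRelativeEnd) (X : C) (m : M) :
    hA.braid X ⊵ₗ m ≫ (αₗ X A.pt m).hom ≫ X ⊴ₗ A.act m =
      (αₗ A.pt X m).hom ≫ A.act (X ⊙ₗ m) :=
  braidingDiagram_iff.1 (hA.braidingDiagram_braid X) m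

/-- The inverse of `σ_X` is the morphism `X ⊗ A ⟶ A ⊗ X` induced by the action of `A` on `m`. -/
lemma isIso_braid (hA : A.IsRelativeEnd) (X : C) : IsIso (hA.braid X) := by
  obtain ⟨t, ht⟩ := hA.exists_right (A.isCentral_actLeft X)
  refine ⟨t, hA.hom_ext_right fun m => ?_, hA.hom_ext_left fun m => ?_⟩
  · rw [comp_actionHomLeft, Category.assoc, ht, hA.braid_act, id_actionHomLeft, Category.id_comp]
  · rw [comp_actionHomLeft, Category.assoc, hA.braid_act, ht, id_actionHomLeft, Category.id_comp]

lemma braid_naturality (hA : A.IsRelativeEnd) {X Y : C} (f : X ⟶ Y) :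
    A.pt ◁ f ≫ hA.braid Y = hA.braid X ≫ f ▷ A.pt := by
  refine hA.hom_ext_left fun m => ?_
  rw [comp_actionHomLeft, comp_actionHomLeft, Category.assoc, Category.assoc, hA.braid_act,
    reassoc_of% whiskerLeft_act, act_natural, reassoc_of% whiskerRight_act, ← action_exchange,
    reassoc_of% hA.braid_act]

lemma braid_tensor (hA : A.IsRelativeEnd) (U V : C) :
    hA.braid (U ⊗ V) = (α_ _ _ _).inv ≫ hA.braid U ▷ V ≫ (α_ _ _ _).hom ≫
      U ◁ hA.braid V ≫ (α_ _ _ _).inv := by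
  refine hA.hom_ext_left fun m => ?_
  rw [hA.braid_act, ← cancel_mono (αₗ U V m).hom]
  simp only [comp_actionHomLeft, Category.assoc]
  rw [tensor_act, reassoc_of% associator_inv_act, reassoc_of% whiskerLeft_act,
    ← actionHomRight_comp, ← actionHomRight_comp, hA.braid_act, actionHomRight_comp,
    associator_actionHom_assoc, reassoc_of% whiskerRight_act, hA.braid_act,
    reassoc_of% associator_inv_act, act_natural]

/-- The half-braiding `σ` of the relative end. -/
noncomputable def halfBraiding (hA : A.IsRelativeEnd) : HalfBraiding A.pt where
  β X := @asIso _ _ _ _ (hA.braid X) (hA.isIso_braid X)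
  monoidal := hA.braid_tensor
  naturality := hA.braid_naturality

end HalfBraiding

lemma existsUnique_mul (hA : A.IsRelativeEnd) :
    ∃! μ : A.pt ⊗ A.pt ⟶ A.pt, A.MulEquation μ := by
  simp only [mulEquation_iff]
  exact hA.existsUnique A.isCentralAction_act_act

lemma existsUnique_unit (hA : A.IsRelativeEnd) :
    ∃! η : 𝟙_ C ⟶ A.pt, A.UnitEquation η := by
  simp only [unitEquation_iff]
  exact hA.existsUnique (isCentralAction_unit D)

section Algebra

variable {μ : A.pt ⊗ A.pt ⟶ A.pt} {η : 𝟙_ C ⟶ A.pt}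

lemma one_mul (hA : A.IsRelativeEnd) (hμ : A.MulEquation μ) (hη : A.UnitEquation η) :
    η ▷ A.pt ≫ μ = (λ_ A.pt).hom := by
  rw [mulEquation_iff] at hμ
  rw [unitEquation_iff] at hη
  refine hA.hom_ext fun m => ?_
  rw [comp_actionHomLeft, Category.assoc, hμ, reassoc_of% whiskerRight_act,
    ← action_exchange_assoc, hη, ← actionUnitIso_hom_naturality, leftUnitor_actionHom,
    Category.assoc]

lemma mul_one (hA : A.IsRelativeEnd) (hμ : A.MulEquation μ) (hη : A.UnitEquation η) :
    A.pt ◁ η ≫ μ = (ρ_ A.pt).hom := by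
  rw [mulEquation_iff] at hμ
  rw [unitEquation_iff] at hη
  refine hA.hom_ext fun m => ?_
  rw [comp_actionHomLeft, Category.assoc, hμ, reassoc_of% whiskerLeft_act,
    ← actionHomRight_comp_assoc, hη, rightUnitor_actionHom, Category.assoc]

lemma mul_assoc (hA : A.IsRelativeEnd) (hμ : A.MulEquation μ) :
    μ ▷ A.pt ≫ μ = (α_ _ _ _).hom ≫ A.pt ◁ μ ≫ μ := by
  rw [mulEquation_iff] at hμ
  refine hA.hom_ext fun m => ?_
  simp only [comp_actionHomLeft, Category.assoc]
  rw [hμ, reassoc_of% whiskerRight_act, ← action_exchange_assoc, hμ, reassoc_of% tensor_act,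
    reassoc_of% whiskerLeft_act, ← actionHomRight_comp_assoc A.pt (μ ⊵ₗ m), hμ,
    actionHomRight_comp_assoc, actionHomRight_comp_assoc, associator_actionHom_assoc]

variable [RigidCategory C]

/-- The multiplication is a morphism in the Drinfeld center. -/
lemma mul_braid (hA : A.IsRelativeEnd) (hμ : A.MulEquation μ) (U : C) :
    μ ▷ U ≫ hA.braid U = ((α_ _ _ _).hom ≫ A.pt ◁ hA.braid U ≫ (α_ _ _ _).inv ≫
      hA.braid U ▷ A.pt ≫ (α_ _ _ _).hom) ≫ U ◁ μ := by
  rw [mulEquation_iff] at hμ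
  refine hA.hom_ext_left fun m => ?_
  simp only [comp_actionHomLeft, Category.assoc]
  rw [hA.braid_act, reassoc_of% whiskerRight_act, hμ, reassoc_of% whiskerLeft_act,
    ← actionHomRight_comp, hμ, actionHomRight_comp, actionHomRight_comp,
    associator_actionHom_assoc, ← reassoc_of% tensor_act, reassoc_of% whiskerRight_act,
    ← action_exchange_assoc, hA.braid_act, reassoc_of% tensor_act, reassoc_of% associator_inv_act,
    reassoc_of% whiskerLeft_act, ← actionHomRight_comp_assoc, ← actionHomRight_comp_assoc,
    Category.assoc, hA.braid_act, actionHomRight_comp_assoc, associator_actionHom_assoc]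

/-- The unit is a morphism in the Drinfeld center. -/
lemma unit_braid (hA : A.IsRelativeEnd) (hη : A.UnitEquation η) (U : C) :
    η ▷ U ≫ hA.braid U = ((λ_ U).hom ≫ (ρ_ U).inv) ≫ U ◁ η := by
  rw [unitEquation_iff] at hη
  refine hA.hom_ext_left fun m => ?_
  simp only [comp_actionHomLeft, Category.assoc]
  rw [hA.braid_act, reassoc_of% whiskerRight_act, hη, reassoc_of% whiskerLeft_act,
    ← actionHomRight_comp, hη, ← rightUnitor_actionHom, inv_hom_actionHomLeft, Category.comp_id,
    leftUnitor_actionHom]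

/-- Commutativity is the naturality of the action of `A` on `m` with respect to the action map
`A ▷ m ⟶ m` itself. -/
lemma braid_mul (hA : A.IsRelativeEnd) (hμ : A.MulEquation μ) : hA.braid A.pt ≫ μ = μ := by
  rw [mulEquation_iff] at hμ
  refine hA.hom_ext fun m => ?_
  rw [comp_actionHomLeft, Category.assoc, hμ, reassoc_of% hA.braid_act, act_natural]

/-- The relative end as an algebra in the Drinfeld center. -/
@[reducible]
noncomputable def monObj (hA : A.IsRelativeEnd) (hμ : A.MulEquation μ) (hη : A.UnitEquation η) :
    MonObj (centerObj A.pt hA.halfBraiding) where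
  one := Center.Hom.mk η (hA.unit_braid hη)
  mul := Center.Hom.mk μ (hA.mul_braid hμ)
  one_mul := Center.ext _ _ (hA.one_mul hμ hη)
  mul_one := Center.ext _ _ (hA.mul_one hμ hη)
  mul_assoc := Center.ext _ _ (hA.mul_assoc hμ)

end Algebra

end RelativeWedge.IsRelativeEnd

end Center

end RelAdj

theorem mainTheorem4
    {k : Type*} [Field k] [IsAlgClosed k] [CharZero k]
    {C : Type*} [Category* C] [Abelian C] [Linear k C] [MonoidalCategory C]
    [MonoidalPreadditive C] [MonoidalLinear k C] [RigidCategory C]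
    [RelAdj.IsFiniteTensorCategory k C]
    {M : Type*} [Category* M] [Abelian M] [Linear k M] [MonoidalLeftAction C M]
    [RelAdj.IsModuleCategory k C M]
    (hexact : RelAdj.IsExactModule C M) (hindec : RelAdj.IsIndecomposableModule C M)
    (D : ObjectProperty (RelAdj.ModEndo k C M)) (hD : RelAdj.IsTensorSubcategory D) :
    Nonempty (RelAdj.InternalHom C M) ∧
    ∀ H : RelAdj.InternalHom C M,
      (∃ A : RelAdj.RelativeWedge D H, A.IsRelativeEnd) ∧
      ∀ A : RelAdj.RelativeWedge D H, A.IsRelativeEnd →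
        (∀ X : C, ∃! s : A.pt ⊗ X ⟶ X ⊗ A.pt, A.BraidingDiagram X s) ∧
        (∃! m : A.pt ⊗ A.pt ⟶ A.pt, A.MulEquation m) ∧
        (∃! u : 𝟙_ C ⟶ A.pt, A.UnitEquation u) ∧
        ∃ σ : HalfBraiding A.pt, (∀ X : C, A.BraidingDiagram X (σ.β X).hom) ∧
          ∃ alg : MonObj (RelAdj.centerObj A.pt σ),
            A.MulEquation alg.mul.f ∧ A.UnitEquation alg.one.f ∧
            IsCommMonObj (RelAdj.centerObj A.pt σ) := by
  have hC : RelAdj.IsFiniteLinear k C := RelAdj.IsFiniteTensorCategory.finite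
  refine ⟨RelAdj.nonempty_internalHom hC, fun H =>
    ⟨RelAdj.RelativeWedge.exists_isRelativeEnd hC D H, fun A hA =>
      ⟨hA.existsUnique_braiding, hA.existsUnique_mul, hA.existsUnique_unit, hA.halfBraiding,
        hA.braidingDiagram_braid, ?_⟩⟩⟩
  obtain ⟨μ, hμ, -⟩ := hA.existsUnique_mul
  obtain ⟨η, hη, -⟩ := hA.existsUnique_unit
  exact ⟨hA.monObj hμ hη, hμ, hη,
    letI := hA.monObj hμ hη
    ⟨Center.ext _ _ (hA.braid_mul hμ)⟩⟩
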